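/- Let $c,\lambda,t>0$. Let $V(0)$ be a random variable with $P\{V(0)=c\}=P\{V(0)=-c\}=\tfrac12$, let $(N(s))_{s\ge 0}$ be a homogeneous Poisson process of rate $\lambda$ independent of $V(0)$, and let $$\mathcal T(s)=\int_0^s V(0)(-1)^{N(u)}\,du,\qquad s\ge 0,$$ be the symmetric telegraph process. For integers $n\ge 0$ let $I_n(x)=\sum_{k\ge 0}\frac{(x/2)^{2k+n}}{k!\,(k+n)!}$ be the modified Bessel function of the first kind. Then $\max_{0\le s\le t}\mathcal T(s)$ is almost surely attained and is a random variable. Conditionally on $V(0)=-c$, its distribution on the open interval $(0,ct)$ has the density $$f(\beta)=e^{-\lambda t}\left[\frac{\lambda t}{ct+\beta}\,I_0\!\left(\frac{\lambda}{c}\sqrt{c^2t^2-\beta^2}\right)+\sqrt{\frac{ct-\beta}{ct+\beta}}\left(\frac{\lambda}{c}-\frac{1}{ct+\beta}\right)I_1\!\left(\frac{\lambda}{c}\sqrt{c^2t^2-\beta^2}\right)\right],\qquad 0<\beta<ct,$$ that is, $f$ is integrable on $(0,ct)$ and $P\{\max_{0\le s\le t}\mathcal T(s)\in A\mid V(0)=-c\}=\int_A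 f(\beta)\,d\beta$ for every Borel set $A\subseteq(0,ct)$. Moreover $$P\Bigl\{\max_{0\le s\le t}\mathcal T(s)=0\,\Big|\,V(0)=-c\Bigr\}=e^{-\lambda t}\bigl[I_0(\lambda t)+I_1(\lambda t)\bigr].$$ -/

import Mathlib

open MeasureTheory ProbabilityTheory Set
open scoped NNReal

/-- The modified Bessel function of the first kind `I_n` of integer order `n ≥ 0`,
`I_n(x) = ∑_{k ≥ 0} (x/2)^(2k+n) / (k! (k+n)!)`. -/
noncomputable def besselI (n : ℕ) (x : ℝ) : ℝ :=
  ∑' k : ℕ, (x / 2) ^ (2 * k + n) / ((k.factorial : ℝ) * ((k + n).factorial : ℝ))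

/-- `N` is a homogeneous Poisson process with rate `lam` under `P`: there are independent
exponential waiting times `τ 0, τ 1, …` of rate `lam` such that, almost surely, `N t` is for every
`t ≥ 0` the number of arrival times `T_{n+1} = τ 0 + ⋯ + τ n` (`n ≥ 0`) that are at most `t`. -/
def IsPoissonProcess {Ω : Type*} [MeasurableSpace Ω] (N : ℝ≥0 → Ω → ℕ) (lam : ℝ)
    (P : Measure Ω) : Prop :=
  (∀ t, Measurable (N t)) ∧
    ∃ τ : ℕ → Ω → ℝ,
      (∀ n, Measurable (τ n)) ∧
      iIndepFun τ P ∧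
      (∀ n, HasLaw (τ n) (expMeasure lam) P) ∧
      ∀ᵐ ω ∂P, ∀ t : ℝ≥0,
        N t ω = {n : ℕ | ∑ i ∈ Finset.range (n + 1), τ i ω ≤ (t : ℝ)}.ncard

/-- The process `T(t) = ∫_0^t V(0) (-1)^{N(s)} ds`, for `t ≥ 0`. -/
noncomputable def telegraph {Ω : Type*} (V₀ : Ω → ℝ) (N : ℝ≥0 → Ω → ℕ) (t : ℝ) (ω : Ω) : ℝ :=
  ∫ s in (0 : ℝ)..t, V₀ ω * (-1) ^ N s.toNNReal ω

/-- The running maximum `max_{0 ≤ s ≤ t} T(s)`. -/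
noncomputable def telegraphMax {Ω : Type*} (V₀ : Ω → ℝ) (N : ℝ≥0 → Ω → ℕ) (t : ℝ) (ω : Ω) : ℝ :=
  sSup ((fun s => telegraph V₀ N s ω) '' Icc 0 t)

/-- `V₀` and `N` drive a symmetric telegraph process with speed `c` and rate `lam`: the initial
velocity `V₀` takes the values `c` and `-c` with probability `1/2` each, `N` is a homogeneous
Poisson process of rate `lam`, and `V₀` is independent of the process `N`. -/
structure IsSymmetricTelegraph {Ω : Type*} [MeasurableSpace Ω] (V₀ : Ω → ℝ) (N : ℝ≥0 → Ω → ℕ)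
    (c lam : ℝ) (P : Measure Ω) : Prop where
  measurable_velocity : Measurable V₀
  velocity_pos : P (V₀ ⁻¹' {c}) = 1 / 2
  velocity_neg : P (V₀ ⁻¹' {-c}) = 1 / 2
  poisson : IsPoissonProcess N lam P
  indep : IndepFun V₀ (fun ω (s : ℝ≥0) => N s ω) P

/-- The density on `(0, ct)` of the maximum up to time `t`, given `V(0) = -c`. -/
noncomputable def maxDensityNeg (c lam t β : ℝ) : ℝ :=
  Real.exp (-lam * t) *
    (lam * t / (c * t + β) * besselI 0 (lam / c * √(c ^ 2 * t ^ 2 - β ^ 2)) +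
      √((c * t - β) / (c * t + β)) * (lam / c - 1 / (c * t + β)) *
        besselI 1 (lam / c * √(c ^ 2 * t ^ 2 - β ^ 2)))

/-! Rescale to unit speed and let F₊(β, t), F₋(β, t) be the probabilities that the path started
upwards, respectively downwards, exceeds β by time t. Conditioning on the first waiting time u gives
two coupled renewal equations: a downward start leads to F₊(β + u, t - u), an upward start to F₋(β -
u, t - u), unless u > β and the first leg crosses by itself.

In the coordinates x = λ(t - β)/2, y = λ(t + β)/2, which each leg changes one at a time, G± = e^{λt}
F± should satisfy ∂ₓG₋ = G₊, ∂ᵧG₊ = G₋, with G₋ = 0 at x = 0 and G₊ = e^{2x} at x = y. For a series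
∑ α(i-j) xⁱyʲ/(i! j!) the partial derivatives only shift α, so the problem becomes one about
coefficients: `upCoeff` and its shift `downCoeff` solve it (`exceedSeries_down_renewal`,
`exceedSeries_up_renewal`). The renewal operator contracts bounded functions by 1 - e^{-λt}, so the
series are the probabilities (`exceedProb_neg_eq`).

Differentiating in β leaves three nonzero coefficients 1, 2, 1, hence I₀, I₁, I₂; a recurrence
removes I₂. The atom at 0 is 1 - F₋(0, t). To pass to the given process, the waiting times are
recovered measurably from N, which makes them independent of V(0). -/

/-! ### Calculus of double exponential series -/

/-- The double exponential series `∑_{i,j} α(i-j) x^i y^j / (i! j!)`. -/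
noncomputable def biexpSeries (α : ℤ → ℝ) (x y : ℝ) : ℝ :=
  ∑' p : ℕ × ℕ, α ((p.1 : ℤ) - p.2) *
    (x ^ p.1 / (p.1.factorial : ℝ) * (y ^ p.2 / (p.2.factorial : ℝ)))

theorem summable_biexp {α : ℤ → ℝ} {C : ℝ} (hα : ∀ m, |α m| ≤ C) (x y : ℝ) :
    Summable fun p : ℕ × ℕ => α ((p.1 : ℤ) - p.2) *
      (x ^ p.1 / (p.1.factorial : ℝ) * (y ^ p.2 / (p.2.factorial : ℝ))) := by
  have h : Summable fun p : ℕ × ℕ =>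
      (|x| ^ p.1 / (p.1.factorial : ℝ)) * (|y| ^ p.2 / (p.2.factorial : ℝ)) :=
    (Real.summable_pow_div_factorial |x|).mul_of_nonneg (Real.summable_pow_div_factorial |y|)
      (fun _ => by positivity) (fun _ => by positivity)
  refine Summable.of_norm_bounded (h.mul_left C) fun p => ?_
  rw [norm_mul, norm_mul, norm_div, norm_div, norm_pow, norm_pow]
  simp only [Real.norm_eq_abs, Nat.abs_cast]
  exact mul_le_mul_of_nonneg_right (hα _) (by positivity)

theorem hasSum_biexp_exp (x y : ℝ) :
    HasSum (fun p : ℕ × ℕ => x ^ p.1 / (p.1.factorial : ℝ) * (y ^ p.2 / (p.2.factorial : ℝ)))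
      (Real.exp (x + y)) := by
  have h (z : ℝ) : HasSum (fun n : ℕ => z ^ n / (n.factorial : ℝ)) (Real.exp z) := by
    rw [Real.exp_eq_exp_ℝ]
    exact NormedSpace.expSeries_div_hasSum_exp z
  have h1 := summable_biexp (α := fun _ => 1) (C := 1) (by simp) x y
  simp only [one_mul] at h1
  rw [Real.exp_add]
  exact (h x).mul (h y) h1

theorem abs_biexpSeries_le {α : ℤ → ℝ} {C : ℝ} (hα : ∀ m, |α m| ≤ C) {x y : ℝ} (hx : 0 ≤ x)
    (hy : 0 ≤ y) : |biexpSeries α x y| ≤ C * Real.exp (x + y) := by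
  rw [← Real.norm_eq_abs]
  refine tsum_of_norm_bounded ((hasSum_biexp_exp x y).mul_left C) fun p => ?_
  rw [norm_mul, Real.norm_eq_abs, Real.norm_of_nonneg (by positivity : (0 : ℝ) ≤
    x ^ p.1 / (p.1.factorial : ℝ) * (y ^ p.2 / (p.2.factorial : ℝ)))]
  exact mul_le_mul_of_nonneg_right (hα _) (by positivity)

theorem biexpSeries_linear {α β : ℤ → ℝ} {C D : ℝ} (hα : ∀ m, |α m| ≤ C) (hβ : ∀ m, |β m| ≤ D)
    (r s x y : ℝ) : biexpSeries (fun m => r * α m + s * β m) x y =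
      r * biexpSeries α x y + s * biexpSeries β x y := by
  unfold biexpSeries
  rw [← tsum_mul_left, ← tsum_mul_left,
    ← ((summable_biexp hα x y).mul_left r).tsum_add ((summable_biexp hβ x y).mul_left s)]
  exact tsum_congr fun p => by ring

theorem hasDerivAt_pow_div_factorial (n : ℕ) (x : ℝ) :
    HasDerivAt (fun x : ℝ => x ^ n / (n.factorial : ℝ))
      (if n = 0 then 0 else x ^ (n - 1) / ((n - 1).factorial : ℝ)) x := by
  have h := (hasDerivAt_pow n x).div_const (n.factorial : ℝ)
  refine h.congr_deriv ?_
  rcases n with _ | n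
  · simp
  · simp only [Nat.add_eq_zero_iff, one_ne_zero, and_false, if_false, Nat.add_sub_cancel,
      Nat.factorial_succ, Nat.cast_mul]
    have : ((n + 1 : ℕ) : ℝ) ≠ 0 := by positivity
    field_simp

theorem summable_pow_pred_div_factorial (x : ℝ) :
    Summable fun n : ℕ => if n = 0 then (0 : ℝ) else x ^ (n - 1) / ((n - 1).factorial : ℝ) := by
  rw [← summable_nat_add_iff 1]
  simpa using Real.summable_pow_div_factorial x

/-- Terms with `p.1 = 0` vanish, and reindexing the others by i ↦ i + 1 raises i - j by one. -/
theorem tsum_biexp_pred_left (α : ℤ → ℝ) (x y : ℝ) :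
    ∑' p : ℕ × ℕ, α ((p.1 : ℤ) - p.2) *
      ((if p.1 = 0 then 0 else x ^ (p.1 - 1) / ((p.1 - 1).factorial : ℝ)) *
        (y ^ p.2 / (p.2.factorial : ℝ))) = biexpSeries (fun m => α (m + 1)) x y := by
  have hinj : Function.Injective fun p : ℕ × ℕ => (p.1 + 1, p.2) := by
    rintro ⟨a, b⟩ ⟨c, d⟩ h
    simpa using h
  rw [← hinj.tsum_eq]
  · refine tsum_congr fun p => ?_
    simp only [Nat.add_eq_zero_iff, one_ne_zero, and_false, if_false, Nat.add_sub_cancel]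
    congr 2
    push_cast
    ring
  · rintro ⟨_ | i, j⟩ h
    · simp at h
    · exact ⟨(i, j), rfl⟩

theorem tsum_biexp_pred_right (α : ℤ → ℝ) (x y : ℝ) :
    ∑' p : ℕ × ℕ, α ((p.1 : ℤ) - p.2) * ((x ^ p.1 / (p.1.factorial : ℝ)) *
      (if p.2 = 0 then 0 else y ^ (p.2 - 1) / ((p.2 - 1).factorial : ℝ))) =
        biexpSeries (fun m => α (m - 1)) x y := by
  have hinj : Function.Injective fun p : ℕ × ℕ => (p.1, p.2 + 1) := by
    rintro ⟨a, b⟩ ⟨c, d⟩ h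
    simpa using h
  rw [← hinj.tsum_eq]
  · refine tsum_congr fun p => ?_
    simp only [Nat.add_eq_zero_iff, one_ne_zero, and_false, if_false, Nat.add_sub_cancel]
    congr 2
    push_cast
    ring
  · rintro ⟨i, _ | j⟩ h
    · simp at h
    · exact ⟨(i, j), rfl⟩

/-- The series is differentiable along every line: `∂_x` shifts the coefficients by `1` and
`∂_y` by `-1`. -/
theorem hasDerivAt_biexpSeries {α : ℤ → ℝ} {C : ℝ} (hα : ∀ m, |α m| ≤ C) (x y a b u : ℝ) :
    HasDerivAt (fun u => biexpSeries α (x + a * u) (y + b * u))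
      (a * biexpSeries (fun m => α (m + 1)) (x + a * u) (y + b * u) +
        b * biexpSeries (fun m => α (m - 1)) (x + a * u) (y + b * u)) u := by
  -- On the bounded interval (-R, R) the two arguments stay within X and Y in absolute value, so the
  -- termwise derivatives have a summable majorant.
  set R := |u| + 1 with hR
  set X := |x| + |a| * R
  set Y := |y| + |b| * R
  have hC : 0 ≤ C := (abs_nonneg _).trans (hα 0)
  have hR0 : 0 ≤ R := by positivity
  have hX0 : 0 ≤ X := by positivity
  have hY0 : 0 ≤ Y := by positivity
  have hX : ∀ v ∈ Ioo (-R) R, |x + a * v| ≤ X := fun v hv => by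
    refine (abs_add_le _ _).trans ?_
    rw [abs_mul]
    exact add_le_add le_rfl (mul_le_mul_of_nonneg_left (abs_lt.2 hv).le (abs_nonneg _))
  have hY : ∀ v ∈ Ioo (-R) R, |y + b * v| ≤ Y := fun v hv => by
    refine (abs_add_le _ _).trans ?_
    rw [abs_mul]
    exact add_le_add le_rfl (mul_le_mul_of_nonneg_left (abs_lt.2 hv).le (abs_nonneg _))
  obtain ⟨e, e_def⟩ : ∃ e : ℕ → ℝ → ℝ, e = fun n z => z ^ n / (n.factorial : ℝ) := ⟨_, rfl⟩
  obtain ⟨d, d_def⟩ : ∃ d : ℕ → ℝ → ℝ, d = fun n z =>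
      if n = 0 then 0 else z ^ (n - 1) / ((n - 1).factorial : ℝ) := ⟨_, rfl⟩
  have hed (n : ℕ) (z : ℝ) : HasDerivAt (e n) (d n z) z := by
    rw [e_def, d_def]
    exact hasDerivAt_pow_div_factorial n z
  have he (n : ℕ) {z Z : ℝ} (h : |z| ≤ Z) : |e n z| ≤ e n Z := by
    simp only [e_def, abs_div, abs_pow, Nat.abs_cast]
    gcongr
  have hd (n : ℕ) {z Z : ℝ} (h : |z| ≤ Z) : |d n z| ≤ d n Z := by
    simp only [d_def]
    split_ifs
    · simp
    · rw [abs_div, abs_pow, Nat.abs_cast]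
      gcongr
  have he0 (n : ℕ) {Z : ℝ} (h : 0 ≤ Z) : 0 ≤ e n Z := by simp only [e_def]; positivity
  have hd0 (n : ℕ) {Z : ℝ} (h : 0 ≤ Z) : 0 ≤ d n Z := by
    simp only [d_def]
    split_ifs
    · simp
    · positivity
  have se (Z : ℝ) : Summable (e · Z) := by
    rw [e_def]
    exact Real.summable_pow_div_factorial Z
  have sd (Z : ℝ) : Summable (d · Z) := by
    rw [d_def]
    exact summable_pow_pred_div_factorial Z
  have sde : Summable fun p : ℕ × ℕ => d p.1 X * e p.2 Y :=
    (sd X).mul_of_nonneg (se Y) (fun n => hd0 n hX0) (fun n => he0 n hY0)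
  have sed : Summable fun p : ℕ × ℕ => e p.1 X * d p.2 Y :=
    (se X).mul_of_nonneg (sd Y) (fun n => he0 n hX0) (fun n => hd0 n hY0)
  have hu : u ∈ Ioo (-R) R := abs_lt.1 (by rw [hR]; linarith)
  have key := hasDerivAt_tsum_of_isPreconnected
    (g := fun (p : ℕ × ℕ) v => α ((p.1 : ℤ) - p.2) * (e p.1 (x + a * v) * e p.2 (y + b * v)))
    (g' := fun (p : ℕ × ℕ) v => α ((p.1 : ℤ) - p.2) *
      (d p.1 (x + a * v) * a * e p.2 (y + b * v) + e p.1 (x + a * v) * (d p.2 (y + b * v) * b)))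
    (u := fun p => C * (|a| * (d p.1 X * e p.2 Y) + |b| * (e p.1 X * d p.2 Y)))
    (t := Ioo (-R) R) (y := u) (y₀ := u)
    (((sde.mul_left |a|).add (sed.mul_left |b|)).mul_left C) isOpen_Ioo isPreconnected_Ioo
    (fun p v _ => by
      have hx : HasDerivAt (fun v => x + a * v) a v := by
        simpa using ((hasDerivAt_id v).const_mul a).const_add x
      have hy : HasDerivAt (fun v => y + b * v) b v := by
        simpa using ((hasDerivAt_id v).const_mul b).const_add y
      exact ((((hed p.1 (x + a * v)).comp v hx).mul
        ((hed p.2 (y + b * v)).comp v hy)).const_mul _))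
    (fun p v hv => by
      have h1 := hd p.1 (hX v hv)
      have h2 := he p.2 (hY v hv)
      have h3 := he p.1 (hX v hv)
      have h4 := hd p.2 (hY v hv)
      rw [norm_mul]
      refine mul_le_mul (hα _) ?_ (norm_nonneg _) hC
      refine (norm_add_le _ _).trans (add_le_add ?_ ?_)
      · rw [Real.norm_eq_abs, abs_mul, abs_mul]
        calc _ = |a| * (|d p.1 (x + a * v)| * |e p.2 (y + b * v)|) := by ring
          _ ≤ _ := by gcongr; exact hd0 _ hX0
      · rw [Real.norm_eq_abs, abs_mul, abs_mul]
        calc _ = |b| * (|e p.1 (x + a * v)| * |d p.2 (y + b * v)|) := by ring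
          _ ≤ _ := by gcongr; exact he0 _ hX0)
    hu (by rw [e_def]; exact summable_biexp hα _ _) hu
  have e_apply (n : ℕ) (z : ℝ) : e n z = z ^ n / (n.factorial : ℝ) := by rw [e_def]
  have d_apply (n : ℕ) (z : ℝ) : d n z =
      if n = 0 then 0 else z ^ (n - 1) / ((n - 1).factorial : ℝ) := by rw [d_def]
  have hS : (fun u => biexpSeries α (x + a * u) (y + b * u)) = fun v => ∑' p : ℕ × ℕ,
      α ((p.1 : ℤ) - p.2) * (e p.1 (x + a * v) * e p.2 (y + b * v)) := by
    rw [e_def]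
    rfl
  rw [hS]
  refine key.congr_deriv ?_
  simp_rw [← tsum_biexp_pred_left, ← tsum_biexp_pred_right, ← d_apply, ← e_apply]
  rw [← tsum_mul_left, ← tsum_mul_left,
    ← Summable.tsum_add]
  · exact tsum_congr fun p => by ring
  · refine Summable.mul_left _ (Summable.of_norm_bounded (sde.mul_left C) fun p => ?_)
    rw [norm_mul, norm_mul]
    exact mul_le_mul (hα _) (mul_le_mul (hd _ (hX u hu)) (he _ (hY u hu)) (norm_nonneg _)
      (hd0 _ hX0)) (by positivity) hC
  · refine Summable.mul_left _ (Summable.of_norm_bounded (sed.mul_left C) fun p => ?_)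
    rw [norm_mul, norm_mul]
    exact mul_le_mul (hα _) (mul_le_mul (he _ (hX u hu)) (hd _ (hY u hu)) (norm_nonneg _)
      (he0 _ hX0)) (by positivity) hC

theorem continuous_biexpSeries_line {α : ℤ → ℝ} {C : ℝ} (hα : ∀ m, |α m| ≤ C) (x y a b : ℝ) :
    Continuous fun u => biexpSeries α (x + a * u) (y + b * u) :=
  continuous_iff_continuousAt.2 fun u => (hasDerivAt_biexpSeries hα x y a b u).continuousAt

theorem biexpSeries_swap {α : ℤ → ℝ} (x y : ℝ) :
    biexpSeries α x y = biexpSeries (fun m => α (-m)) y x := by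
  unfold biexpSeries
  rw [← (Equiv.prodComm ℕ ℕ).tsum_eq]
  refine tsum_congr fun p => ?_
  simp only [Equiv.prodComm_apply, Prod.fst_swap, Prod.snd_swap, neg_sub]
  ring

/-- Swapping the two summation indices replaces α(m) by α(-m), so on the diagonal only the mean of
the two counts, and that mean is 1. -/
theorem biexpSeries_diag {α : ℤ → ℝ} {C : ℝ} (hα : ∀ m, |α m| ≤ C)
    (h : ∀ m, α m + α (-m) = 2) (x : ℝ) : biexpSeries α x x = Real.exp (2 * x) := by
  have h1 : biexpSeries (fun m => 1 * α m + 1 * α (-m)) x x = 2 * Real.exp (x + x) := by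
    simp only [one_mul, h]
    exact ((hasSum_biexp_exp x x).mul_left 2).tsum_eq
  rw [biexpSeries_linear hα (fun m => hα (-m)), ← biexpSeries_swap] at h1
  rw [two_mul]
  linarith

theorem biexpSeries_zero_left {α : ℤ → ℝ} (h : ∀ m ≤ 0, α m = 0) (y : ℝ) :
    biexpSeries α 0 y = 0 := by
  unfold biexpSeries
  refine (tsum_congr fun p => ?_).trans tsum_zero
  rcases p with ⟨_ | i, j⟩
  · rw [h _ (by simp)]
    simp
  · simp

/-- Coefficients concentrated at `k` give a single series. -/
theorem biexpSeries_single (k : ℕ) (x y : ℝ) :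
    biexpSeries (fun m => if m = k then 1 else 0) x y =
      ∑' j : ℕ, x ^ (j + k) / ((j + k).factorial : ℝ) * (y ^ j / (j.factorial : ℝ)) := by
  have hinj : Function.Injective fun j : ℕ => (j + k, j) := fun a b h => by
    simpa using congrArg Prod.snd h
  unfold biexpSeries
  rw [← hinj.tsum_eq]
  · refine tsum_congr fun j => ?_
    simp
  · rintro ⟨i, j⟩ h
    have : (i : ℤ) - j = k := by
      by_contra hne
      simp [hne] at h
    refine ⟨j, ?_⟩
    simp only [Prod.mk.injEq, and_true]
    omega

theorem summable_biexp_single (k : ℕ) (x y : ℝ) : Summable fun j : ℕ =>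
    x ^ (j + k) / ((j + k).factorial : ℝ) * (y ^ j / (j.factorial : ℝ)) := by
  have h := summable_biexp (α := fun _ => 1) (C := 1) (by simp) x y
  simp only [one_mul] at h
  exact h.comp_injective (i := fun j : ℕ => (j + k, j)) fun a b h => by
    simpa using congrArg Prod.snd h

/-- The modified Bessel function times a power of `√(x / y)` as a biexponential series. -/
theorem biexpSeries_single_eq_besselI (k : ℕ) {x y : ℝ} (hx : 0 ≤ x) (hy : 0 < y) :
    biexpSeries (fun m => if m = k then 1 else 0) x y =
      √(x / y) ^ k * besselI k (2 * √(x * y)) := by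
  rw [biexpSeries_single, besselI, ← tsum_mul_left]
  refine tsum_congr fun j => ?_
  rw [mul_div_cancel_left₀ _ two_ne_zero, pow_add (√(x * y)), pow_mul, Real.sq_sqrt (by positivity)]
  have h : √(x / y) ^ k * √(x * y) ^ k = x ^ k := by
    rw [← mul_pow, ← Real.sqrt_mul (by positivity), show x / y * (x * y) = x ^ 2 by field_simp,
      Real.sqrt_sq hx]
  have h1 : (j.factorial : ℝ) ≠ 0 := by positivity
  have h2 : ((j + k).factorial : ℝ) ≠ 0 := by positivity
  rw [pow_add x, ← h, mul_pow]
  field_simp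

/-- This is I₂(z) = I₀(z) - (2/z) I₁(z) in terms of x and y. On the right the term j = 0 cancels,
and term j + 1 equals term j on the left. -/
theorem biexpSeries_single_recurrence (x y : ℝ) :
    y * biexpSeries (fun m => if m = (2 : ℕ) then 1 else 0) x y =
      x * biexpSeries (fun m => if m = (0 : ℕ) then 1 else 0) x y -
        biexpSeries (fun m => if m = (1 : ℕ) then 1 else 0) x y := by
  simp only [biexpSeries_single]
  rw [← tsum_mul_left, ← tsum_mul_left,
    ← ((summable_biexp_single 0 x y).mul_left x).tsum_sub (summable_biexp_single 1 x y),
    (((summable_biexp_single 0 x y).mul_left x).sub (summable_biexp_single 1 x y)).tsum_eq_zero_add]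
  simp only [add_zero, zero_add, pow_zero, Nat.factorial_zero, Nat.factorial_one, Nat.cast_one,
    pow_one, div_one, mul_one, sub_self]
  refine tsum_congr fun j => ?_
  have h1 : (j.factorial : ℝ) ≠ 0 := by positivity
  have e1 : ((j + 1).factorial : ℝ) = (j + 1) * j.factorial := by
    rw [Nat.factorial_succ]; push_cast; ring
  have e2 : ((j + 2).factorial : ℝ) = (j + 2) * ((j + 1) * j.factorial) := by
    rw [Nat.factorial_succ, Nat.factorial_succ]; push_cast; ring
  have h2 : (j : ℝ) + 1 ≠ 0 := by positivity
  have h3 : (j : ℝ) + 2 ≠ 0 := by positivity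
  rw [show j + 1 + 1 = j + 2 by ring, e2, e1]
  field_simp
  ring

/-! ### Paths driven by waiting times -/

/-- The number of arrivals up to time `u` when the waiting times are `x 0, x 1, …`. -/
noncomputable def arrivalCount (x : ℕ → ℝ) (u : ℝ) : ℕ :=
  {n : ℕ | ∑ i ∈ Finset.range (n + 1), x i ≤ u}.ncard

/-- The path of unit speed which starts upwards and turns at each arrival. -/
noncomputable def unitPath (x : ℕ → ℝ) (s : ℝ) : ℝ :=
  ∫ u in (0 : ℝ)..s, (-1) ^ arrivalCount x u

/-- The waiting time sequences for which `σ` times the unit speed path exceeds `β` by time `t`. -/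
def exceedSet (σ β t : ℝ) : Set (ℕ → ℝ) :=
  {x | ∃ s ∈ Icc 0 t, β < σ * unitPath x s}

/-- Positive waiting times with finitely many arrivals in bounded time. -/
def RegularWaiting (x : ℕ → ℝ) : Prop :=
  (∀ n, 0 < x n) ∧ ∀ u : ℝ, {n : ℕ | ∑ i ∈ Finset.range (n + 1), x i ≤ u}.Finite

/-- The sequence `u, y 0, y 1, …`. -/
def seqCons (u : ℝ) (y : ℕ → ℝ) : ℕ → ℝ
  | 0 => u
  | n + 1 => y n

theorem measurable_seqCons : Measurable fun p : ℝ × (ℕ → ℝ) => seqCons p.1 p.2 := by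
  refine measurable_pi_iff.2 fun n => ?_
  rcases n with _ | n
  · exact measurable_fst
  · exact (measurable_pi_apply n).comp measurable_snd

theorem measurable_arrivalCount :
    Measurable fun p : (ℕ → ℝ) × ℝ => arrivalCount p.1 p.2 := by
  refine measurable_ncard.comp (measurable_set_iff.2 fun n => ?_)
  refine measurableSet_setOfPred.1 (measurableSet_le ?_ measurable_snd)
  exact Finset.measurable_sum _ fun i _ => (measurable_pi_apply i).comp measurable_fst

theorem measurable_neg_one_pow_arrivalCount :
    Measurable fun p : (ℕ → ℝ) × ℝ => (-1 : ℝ) ^ arrivalCount p.1 p.2 :=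
  (Measurable.of_discrete (f := fun n : ℕ => (-1 : ℝ) ^ n)).comp measurable_arrivalCount

theorem measurable_unitPath (s : ℝ) : Measurable fun x => unitPath x s := by
  unfold unitPath intervalIntegral
  exact ((measurable_neg_one_pow_arrivalCount.stronglyMeasurable.integral_prod_right).sub
    (measurable_neg_one_pow_arrivalCount.stronglyMeasurable.integral_prod_right)).measurable

theorem intervalIntegrable_neg_one_pow_arrivalCount (x : ℕ → ℝ) (a b : ℝ) :
    IntervalIntegrable (fun u => (-1 : ℝ) ^ arrivalCount x u) volume a b := by
  refine (intervalIntegrable_const (c := (1 : ℝ))).mono_fun ?_ ?_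
  · exact (measurable_neg_one_pow_arrivalCount.comp
      (measurable_const.prodMk measurable_id)).aestronglyMeasurable
  · exact Filter.Eventually.of_forall fun u => by simp

theorem abs_unitPath_sub_le (x : ℕ → ℝ) (r s : ℝ) :
    |unitPath x s - unitPath x r| ≤ |s - r| := by
  unfold unitPath
  rw [intervalIntegral.integral_interval_sub_left
    (intervalIntegrable_neg_one_pow_arrivalCount x _ _)
    (intervalIntegrable_neg_one_pow_arrivalCount x _ _), ← one_mul |s - r|, ← Real.norm_eq_abs]
  exact intervalIntegral.norm_integral_le_of_norm_le_const fun u _ => by simp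

theorem unitPath_zero (x : ℕ → ℝ) : unitPath x 0 = 0 := by simp [unitPath]

theorem abs_unitPath_le (x : ℕ → ℝ) (s : ℝ) : |unitPath x s| ≤ |s| := by
  simpa [unitPath_zero] using abs_unitPath_sub_le x 0 s

theorem continuous_unitPath (x : ℕ → ℝ) : Continuous (unitPath x) :=
  (LipschitzWith.of_dist_le_mul (K := 1) fun s r => by
    simpa [Real.dist_eq] using abs_unitPath_sub_le x r s).continuous

/-- Turns exceedance into a countable union, for measurability; clamping q keeps the time inside
`Icc 0 t`. -/
theorem exists_Icc_iff_exists_rat {f : ℝ → ℝ} (hf : Continuous f) {t : ℝ} (ht : 0 ≤ t) (β : ℝ) :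
    (∃ s ∈ Icc 0 t, β < f s) ↔ ∃ q : ℚ, β < f (max 0 (min (q : ℝ) t)) := by
  constructor
  · rintro ⟨s, hs, h⟩
    have ho : IsOpen {r : ℝ | β < f (max 0 (min r t))} :=
      isOpen_lt continuous_const (hf.comp (by fun_prop))
    have hmem : s ∈ {r : ℝ | β < f (max 0 (min r t))} := by
      rw [mem_ofPred_eq, min_eq_left hs.2, max_eq_right hs.1]
      exact h
    exact Rat.denseRange_cast.exists_mem_open ho ⟨s, hmem⟩
  · rintro ⟨q, h⟩
    exact ⟨_, ⟨le_max_left _ _, max_le ht (min_le_right _ _)⟩, h⟩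

theorem measurableSet_exceedSet (σ β t : ℝ) : MeasurableSet (exceedSet σ β t) := by
  rcases lt_or_ge t 0 with ht | ht
  · have : exceedSet σ β t = ∅ := by simp [exceedSet, Icc_eq_empty ht.not_ge]
    simp [this]
  · simp only [exceedSet,
      fun x => exists_Icc_iff_exists_rat ((continuous_unitPath x).const_mul σ) ht β]
    rw [ofPred_exists]
    exact MeasurableSet.iUnion fun q =>
      measurableSet_lt measurable_const ((measurable_unitPath _).const_mul σ)

theorem exceedSet_eq_empty {σ β t : ℝ} (hσ : |σ| = 1) (h : t ≤ β) : exceedSet σ β t = ∅ := by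
  refine eq_empty_of_forall_notMem ?_
  rintro x ⟨s, hs, hlt⟩
  have h1 := (le_abs_self _).trans_eq (abs_mul σ (unitPath x s))
  rw [hσ, one_mul] at h1
  have h2 := abs_unitPath_le x s
  rw [abs_of_nonneg hs.1] at h2
  linarith [hs.2]

/-! ### Decomposition of the path at its first turn -/

theorem sum_range_seqCons (u : ℝ) (y : ℕ → ℝ) (n : ℕ) :
    ∑ i ∈ Finset.range (n + 1), seqCons u y i = u + ∑ i ∈ Finset.range n, y i := by
  rw [Finset.sum_range_succ', add_comm]
  rfl

theorem arrivalCount_seqCons_of_lt {u v : ℝ} {y : ℕ → ℝ} (hy : RegularWaiting y) (h : v < u) :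
    arrivalCount (seqCons u y) v = 0 := by
  have : {n : ℕ | ∑ i ∈ Finset.range (n + 1), seqCons u y i ≤ v} = ∅ := by
    refine eq_empty_of_forall_notMem fun n hn => ?_
    rw [mem_ofPred_eq, sum_range_seqCons] at hn
    have := Finset.sum_nonneg fun i (_ : i ∈ Finset.range n) => (hy.1 i).le
    linarith
  rw [arrivalCount, this, ncard_empty]

theorem arrivalCount_seqCons_of_ge {u v : ℝ} {y : ℕ → ℝ} (hy : RegularWaiting y) (h : u ≤ v) :
    arrivalCount (seqCons u y) v = arrivalCount y (v - u) + 1 := by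
  have : {n : ℕ | ∑ i ∈ Finset.range (n + 1), seqCons u y i ≤ v} =
      insert 0 (Nat.succ '' {n : ℕ | ∑ i ∈ Finset.range (n + 1), y i ≤ v - u}) := by
    ext n
    rw [mem_ofPred_eq, sum_range_seqCons]
    rcases n with _ | n
    · simpa using h
    · simp [le_sub_iff_add_le']
  -- Finiteness is essential: `ncard` of an infinite set is 0.
  rw [arrivalCount, this, ncard_insert_of_notMem (by simp) ((hy.2 _).image _),
    ncard_image_of_injective _ Nat.succ_injective, arrivalCount]

theorem unitPath_seqCons_of_le {u s : ℝ} {y : ℕ → ℝ} (hy : RegularWaiting y) (hs : 0 ≤ s)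
    (h : s ≤ u) : unitPath (seqCons u y) s = s := by
  have : unitPath (seqCons u y) s = ∫ _ in (0 : ℝ)..s, (1 : ℝ) := by
    refine intervalIntegral.integral_congr_ae ?_
    -- The endpoint is discarded because for s = u the arrival at u is already counted there.
    have hne : ∀ᵐ v : ℝ, v ≠ s := by simp [ae_iff]
    filter_upwards [hne] with v hv hmem
    rw [uIoc_of_le hs] at hmem
    rw [arrivalCount_seqCons_of_lt hy ((lt_of_le_of_ne hmem.2 hv).trans_le h), pow_zero]
  simpa using this

theorem unitPath_seqCons_of_ge {u s : ℝ} {y : ℕ → ℝ} (hy : RegularWaiting y) (hu : 0 ≤ u)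
    (h : u ≤ s) : unitPath (seqCons u y) s = u - unitPath y (s - u) := by
  have h1 : unitPath (seqCons u y) s = unitPath (seqCons u y) u +
      ∫ v in u..s, (-1 : ℝ) ^ arrivalCount (seqCons u y) v :=
    (intervalIntegral.integral_add_adjacent_intervals
      (intervalIntegrable_neg_one_pow_arrivalCount _ _ _)
      (intervalIntegrable_neg_one_pow_arrivalCount _ _ _)).symm
  have h2 : ∫ v in u..s, (-1 : ℝ) ^ arrivalCount (seqCons u y) v =
      ∫ v in u..s, -(-1 : ℝ) ^ arrivalCount y (v - u) := by
    refine intervalIntegral.integral_congr fun v hv => ?_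
    rw [uIcc_of_le h] at hv
    simp only [arrivalCount_seqCons_of_ge hy hv.1, pow_succ, mul_neg, mul_one]
  rw [h1, h2, unitPath_seqCons_of_le hy hu le_rfl, intervalIntegral.integral_neg,
    intervalIntegral.integral_comp_sub_right (fun w => (-1 : ℝ) ^ arrivalCount y w), sub_self,
    unitPath, ← sub_eq_add_neg]

/-- The first leg stays at or below 0 ≤ β; at time u the path restarts upwards from -u with time t -
u left. -/
theorem seqCons_mem_exceedSet_neg {u β t : ℝ} {y : ℕ → ℝ} (hy : RegularWaiting y) (hu : 0 < u)
    (hβ : 0 ≤ β) :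
    seqCons u y ∈ exceedSet (-1) β t ↔ y ∈ exceedSet 1 (β + u) (t - u) := by
  constructor
  · rintro ⟨s, hs, h⟩
    rcases le_total s u with hsu | hsu
    · rw [unitPath_seqCons_of_le hy hs.1 hsu] at h
      linarith [hs.1]
    · rw [unitPath_seqCons_of_ge hy hu.le hsu] at h
      exact ⟨s - u, ⟨sub_nonneg.2 hsu, sub_le_sub_right hs.2 _⟩, by linarith⟩
  · rintro ⟨s, hs, h⟩
    refine ⟨s + u, ⟨by linarith [hs.1], by linarith [hs.2]⟩, ?_⟩
    rw [unitPath_seqCons_of_ge hy hu.le (by linarith [hs.1]), add_sub_cancel_right]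
    linarith

/-- The first leg only reaches u ≤ β; the path then restarts downwards from height u. -/
theorem seqCons_mem_exceedSet_pos {u β t : ℝ} {y : ℕ → ℝ} (hy : RegularWaiting y) (hu : 0 < u)
    (huβ : u ≤ β) :
    seqCons u y ∈ exceedSet 1 β t ↔ y ∈ exceedSet (-1) (β - u) (t - u) := by
  constructor
  · rintro ⟨s, hs, h⟩
    rcases le_total s u with hsu | hsu
    · rw [unitPath_seqCons_of_le hy hs.1 hsu] at h
      linarith [hs.1]
    · rw [unitPath_seqCons_of_ge hy hu.le hsu] at h
      exact ⟨s - u, ⟨sub_nonneg.2 hsu, sub_le_sub_right hs.2 _⟩, by linarith⟩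
  · rintro ⟨s, hs, h⟩
    refine ⟨s + u, ⟨by linarith [hs.1], by linarith [hs.2]⟩, ?_⟩
    rw [unitPath_seqCons_of_ge hy hu.le (by linarith [hs.1]), add_sub_cancel_right]
    linarith

theorem seqCons_mem_exceedSet_of_lt {u β t : ℝ} {y : ℕ → ℝ} (hy : RegularWaiting y)
    (hβ : 0 ≤ β) (ht : β < t) (hu : β < u) : seqCons u y ∈ exceedSet 1 β t := by
  have hm : β < min u t := lt_min hu ht
  refine ⟨min u t, ⟨hβ.trans hm.le, min_le_right _ _⟩, ?_⟩
  rw [unitPath_seqCons_of_le hy (hβ.trans hm.le) (min_le_left _ _)]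
  linarith

/-! ### Independent exponential waiting times -/

theorem expMeasure_eq_withDensity (lam : ℝ) :
    expMeasure lam = (volume.restrict (Ioi 0)).withDensity
      fun u => ENNReal.ofReal (lam * Real.exp (-(lam * u))) := by
  rw [expMeasure, gammaMeasure, ← withDensity_indicator measurableSet_Ioi]
  refine withDensity_congr_ae ?_
  have hne : ∀ᵐ v : ℝ, v ≠ 0 := by simp [ae_iff]
  filter_upwards [hne] with u hu
  change exponentialPDF lam u = _
  rw [exponentialPDF_eq]
  rcases lt_or_gt_of_ne hu with h | h
  · rw [if_neg h.not_ge, indicator_of_notMem (by simpa using h.le), ENNReal.ofReal_zero]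
  · rw [if_pos h.le, indicator_of_mem (by simpa using h)]

theorem ae_pos_expMeasure (lam : ℝ) : ∀ᵐ u ∂expMeasure lam, 0 < u := by
  rw [expMeasure_eq_withDensity]
  exact (withDensity_absolutelyContinuous _ _).ae_le (ae_restrict_mem measurableSet_Ioi)

theorem integral_expMeasure {lam : ℝ} (hlam : 0 < lam) (F : ℝ → ℝ) :
    ∫ u, F u ∂expMeasure lam = ∫ u in Ioi 0, lam * Real.exp (-(lam * u)) * F u := by
  rw [expMeasure_eq_withDensity, integral_withDensity_eq_integral_toReal_smul
    (by fun_prop) (by simp)]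
  refine integral_congr_ae (Filter.Eventually.of_forall fun u => ?_)
  simp only [smul_eq_mul]
  rw [ENNReal.toReal_ofReal (by positivity)]

/-- Prepending an independent copy to an i.i.d. sequence does not change its law. With Fubini, this
is what permits conditioning on the first waiting time. -/
theorem map_seqCons_infinitePi (ν : Measure ℝ) [IsProbabilityMeasure ν] :
    (ν.prod (Measure.infinitePi fun _ : ℕ => ν)).map (fun p => seqCons p.1 p.2) =
      Measure.infinitePi fun _ : ℕ => ν := by
  refine Measure.eq_infinitePi _ fun s t ht => ?_
  classical
  have hmeas : MeasurableSet (Set.pi (s : Set ℕ) t) :=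
    MeasurableSet.pi s.countable_toSet fun i _ => ht i
  -- Unconstrained coordinates get `univ`, so the box becomes one over an initial segment and its
  -- first coordinate can be split off.
  let t' : ℕ → Set ℝ := fun i => if i ∈ s then t i else univ
  obtain ⟨n, hn⟩ := s.exists_nat_subset_range
  have ht' (i : ℕ) : MeasurableSet (t' i) := by
    simp only [t']
    split_ifs
    · exact ht i
    · exact MeasurableSet.univ
  have hpre : (fun p : ℝ × (ℕ → ℝ) => seqCons p.1 p.2) ⁻¹' (Set.pi (s : Set ℕ) t) =
      t' 0 ×ˢ Set.pi (Finset.range n : Set ℕ) fun i => t' (i + 1) := by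
    ext ⟨u, y⟩
    simp only [mem_preimage, Set.mem_pi, mem_prod, t', Finset.mem_coe, Finset.mem_range]
    constructor
    · intro h
      refine ⟨?_, fun i _ => ?_⟩
      · split_ifs with h0
        · exact h 0 h0
        · trivial
      · split_ifs with h0
        · exact h (i + 1) h0
        · trivial
    · rintro ⟨h0, h1⟩ i hi
      rcases i with _ | i
      · rw [if_pos hi] at h0
        exact h0
      · have := h1 i (by have := Finset.mem_range.1 (hn hi); omega)
        rw [if_pos hi] at this
        exact this
  rw [Measure.map_apply measurable_seqCons hmeas, hpre, Measure.prod_prod,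
    Measure.infinitePi_pi _ (fun i _ => ht' _), mul_comm,
    ← Finset.prod_range_succ' (fun i => ν (t' i))]
  have hsub : s ⊆ Finset.range (n + 1) := hn.trans (Finset.range_subset_range.2 (Nat.le_succ n))
  rw [← Finset.prod_subset hsub (fun i _ hi => by simp [t', hi])]
  exact Finset.prod_congr rfl fun i hi => by simp [t', hi]

theorem infinitePi_apply_eq_lintegral (ν : Measure ℝ) [IsProbabilityMeasure ν]
    {E : Set (ℕ → ℝ)} (hE : MeasurableSet E) :
    (Measure.infinitePi fun _ : ℕ => ν) E =
      ∫⁻ u, (Measure.infinitePi fun _ : ℕ => ν) {y | seqCons u y ∈ E} ∂ν := by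
  conv_lhs => rw [← map_seqCons_infinitePi ν, Measure.map_apply measurable_seqCons hE,
    Measure.prod_apply (measurable_seqCons hE)]
  rfl

theorem measurable_infinitePi_seqCons (ν : Measure ℝ) [IsProbabilityMeasure ν]
    {E : Set (ℕ → ℝ)} (hE : MeasurableSet E) :
    Measurable fun u => (Measure.infinitePi fun _ : ℕ => ν) {y | seqCons u y ∈ E} :=
  measurable_measure_prodMk_left (measurable_seqCons hE)

theorem infinitePi_real_eq_integral (ν : Measure ℝ) [IsProbabilityMeasure ν]
    {E : Set (ℕ → ℝ)} (hE : MeasurableSet E) :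
    (Measure.infinitePi fun _ : ℕ => ν).real E =
      ∫ u, (Measure.infinitePi fun _ : ℕ => ν).real {y | seqCons u y ∈ E} ∂ν := by
  simp only [measureReal_def]
  rw [integral_toReal (measurable_infinitePi_seqCons ν hE).aemeasurable
    (Filter.Eventually.of_forall fun u => measure_lt_top _ _), ← infinitePi_apply_eq_lintegral ν hE]

/-- Infinitely many arrivals in bounded time would make ∑ x n converge, forcing x n → 0. -/
theorem regularWaiting_of_frequently {x : ℕ → ℝ} (hpos : ∀ n, 0 < x n)
    (hx : ∃ᶠ n in Filter.atTop, 1 < x n) : RegularWaiting x := by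
  refine ⟨hpos, fun u => ?_⟩
  by_contra hinf
  have hle (n : ℕ) : ∑ i ∈ Finset.range n, x i ≤ u := by
    obtain ⟨m, hm, hnm⟩ := Set.Infinite.exists_gt hinf n
    refine le_trans ?_ hm
    exact Finset.sum_le_sum_of_subset_of_nonneg (Finset.range_subset_range.2 (by omega))
      fun i _ _ => (hpos i).le
  have hs := summable_of_sum_range_le (fun n => (hpos n).le) hle
  have h1 := hs.tendsto_atTop_zero.eventually (gt_mem_nhds zero_lt_one)
  obtain ⟨n, hn1, hn2⟩ := (hx.and_eventually h1).exists
  exact lt_asymm hn1 hn2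

/-- The independent events 1 < x n share one positive probability, so the second Borel–Cantelli
lemma applies. -/
theorem ae_regularWaiting {lam : ℝ} (hlam : 0 < lam) :
    ∀ᵐ x ∂(Measure.infinitePi fun _ : ℕ => expMeasure lam), RegularWaiting x := by
  have := isProbabilityMeasure_expMeasure hlam
  set μ := Measure.infinitePi fun _ : ℕ => expMeasure lam
  have hpos : ∀ᵐ x ∂μ, ∀ n, 0 < x n := ae_all_iff.2 fun n => by
    have h := ae_pos_expMeasure lam
    rw [← Measure.infinitePi_map_eval (fun _ : ℕ => expMeasure lam) n] at h
    exact ae_of_ae_map (measurable_pi_apply n).aemeasurable h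
  have hval (n : ℕ) : μ {x | 1 < x n} = expMeasure lam (Ioi 1) := by
    rw [← Measure.infinitePi_map_eval (fun _ : ℕ => expMeasure lam) n,
      Measure.map_apply (measurable_pi_apply n) measurableSet_Ioi]
    rfl
  have hne : expMeasure lam (Ioi 1) ≠ 0 := by
    rw [expMeasure_eq_withDensity, withDensity_apply _ measurableSet_Ioi,
      Measure.restrict_restrict measurableSet_Ioi,
      inter_eq_left.2 (Ioi_subset_Ioi zero_le_one)]
    refine (setLIntegral_pos_iff (by fun_prop)).2 ?_ |>.ne'
    have : Function.support (fun u => ENNReal.ofReal (lam * Real.exp (-(lam * u)))) = univ := by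
      ext u
      simp only [Function.mem_support, ne_eq, ENNReal.ofReal_eq_zero, not_le, mem_univ, iff_true]
      positivity
    rw [this, univ_inter]
    simp
  have hind : iIndepSet (fun n : ℕ => {x : ℕ → ℝ | 1 < x n}) μ := by
    have h := iIndepFun_infinitePi (P := fun _ : ℕ => expMeasure lam) (X := fun _ (x : ℝ) => x)
      (fun _ => measurable_id)
    refine (iIndepSet_iff_meas_biInter fun n =>
      measurableSet_lt measurable_const (measurable_pi_apply n)).2 fun s => ?_
    exact h.measure_inter_preimage_eq_mul s (sets := fun _ => Ioi 1) fun i _ => measurableSet_Ioi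
  have hlim := measure_limsup_eq_one (fun n : ℕ =>
      measurableSet_lt (measurable_const (a := (1 : ℝ))) (measurable_pi_apply n)) hind
    (by simp_rw [hval]; exact ENNReal.tsum_const_eq_top_of_ne_zero hne)
  have hfreq : ∀ᵐ x ∂μ, ∃ᶠ n in Filter.atTop, 1 < x n := by
    have := (prob_compl_eq_zero_iff (MeasurableSet.measurableSet_limsup fun n : ℕ =>
      measurableSet_lt (measurable_const (a := (1 : ℝ))) (measurable_pi_apply n))).2 hlim
    filter_upwards [compl_mem_ae_iff.2 this] with x hx
    rw [compl_compl, Filter.mem_limsup_iff_frequently_mem] at hx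
    exact hx
  filter_upwards [hpos, hfreq] with x h1 h2 using regularWaiting_of_frequently h1 h2

/-! ### Renewal equations and their unique solution -/

/-- The probability that `σ` times the unit speed path exceeds `β` by time `t`. -/
noncomputable def exceedProb (lam σ β t : ℝ) : ℝ :=
  (Measure.infinitePi fun _ : ℕ => expMeasure lam).real (exceedSet σ β t)

/-- The same probability given that the first waiting time is `u`. -/
noncomputable def exceedProbGiven (lam σ β t u : ℝ) : ℝ :=
  (Measure.infinitePi fun _ : ℕ => expMeasure lam).real {y | seqCons u y ∈ exceedSet σ β t}

/-- Coefficients of the exceedance probability for an upward start. -/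
def upCoeff (m : ℤ) : ℝ := if m < 0 then 0 else if m = 0 then 1 else 2

/-- Coefficients of the exceedance probability for a downward start. -/
def downCoeff (m : ℤ) : ℝ := upCoeff (m - 1)

theorem abs_upCoeff_le (m : ℤ) : |upCoeff m| ≤ 2 := by
  unfold upCoeff
  split_ifs <;> norm_num

theorem abs_downCoeff_le (m : ℤ) : |downCoeff m| ≤ 2 := abs_upCoeff_le _

theorem upCoeff_add_neg (m : ℤ) : upCoeff m + upCoeff (-m) = 2 := by
  unfold upCoeff
  rcases lt_trichotomy m 0 with h | h | h
  · rw [if_pos h, if_neg (by omega), if_neg (by omega)]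
    norm_num
  · subst h
    norm_num
  · rw [if_neg (by omega), if_neg (by omega), if_pos (by omega)]
    norm_num

theorem downCoeff_of_nonpos {m : ℤ} (h : m ≤ 0) : downCoeff m = 0 := by
  rw [downCoeff, upCoeff, if_pos (by omega)]

/-- The closed form of the exceedance probability with coefficients `α`. -/
noncomputable def exceedSeries (lam : ℝ) (α : ℤ → ℝ) (β t : ℝ) : ℝ :=
  Real.exp (-(lam * t)) * biexpSeries α (lam * (t - β) / 2) (lam * (t + β) / 2)

section

variable {lam : ℝ}

theorem exceedProb_eq_integral (hlam : 0 < lam) (σ β t : ℝ) :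
    exceedProb lam σ β t =
      ∫ u in Ioi 0, lam * Real.exp (-(lam * u)) * exceedProbGiven lam σ β t u := by
  have := isProbabilityMeasure_expMeasure hlam
  rw [exceedProb, infinitePi_real_eq_integral _ (measurableSet_exceedSet σ β t),
    integral_expMeasure hlam]
  rfl

theorem integrableOn_rate_exp (hlam : 0 < lam) (a : ℝ) :
    IntegrableOn (fun u => lam * Real.exp (-(lam * u))) (Ioi a) := by
  simp only [← neg_mul]
  exact (integrableOn_exp_mul_Ioi (neg_neg_of_pos hlam) a).const_mul lam

theorem integral_rate_exp_Ioi (hlam : 0 < lam) (a : ℝ) :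
    ∫ u in Ioi a, lam * Real.exp (-(lam * u)) = Real.exp (-(lam * a)) := by
  simp only [← neg_mul]
  rw [integral_const_mul, integral_exp_mul_Ioi (neg_neg_of_pos hlam)]
  field_simp

theorem integral_rate_exp (lam T : ℝ) :
    ∫ u in (0 : ℝ)..T, lam * Real.exp (-(lam * u)) = 1 - Real.exp (-(lam * T)) := by
  rw [intervalIntegral.integral_eq_sub_of_hasDerivAt
    (f := fun u => -Real.exp (-(lam * u))) (fun u _ => hasDerivAt_neg_exp_mul_exp)
    (Continuous.intervalIntegrable (by fun_prop) _ _)]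
  simp
  ring

theorem integrableOn_rate_exp_mul_exceedProbGiven (hlam : 0 < lam) (σ β t : ℝ) :
    IntegrableOn (fun u => lam * Real.exp (-(lam * u)) * exceedProbGiven lam σ β t u)
      (Ioi 0) := by
  have := isProbabilityMeasure_expMeasure hlam
  refine (integrableOn_rate_exp hlam 0).mono' ?_ (Filter.Eventually.of_forall fun u => ?_)
  · refine Measurable.aestronglyMeasurable (Measurable.mul (by fun_prop) ?_)
    exact (measurable_infinitePi_seqCons _ (measurableSet_exceedSet σ β t)).ennreal_toReal
  · have h1 : 0 ≤ exceedProbGiven lam σ β t u := measureReal_nonneg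
    have h2 : exceedProbGiven lam σ β t u ≤ 1 := measureReal_le_one
    rw [Real.norm_of_nonneg (by positivity)]
    exact mul_le_of_le_one_right (by positivity) h2

theorem exceedProbGiven_neg (hlam : 0 < lam) {β t u : ℝ} (hβ : 0 ≤ β) (hu : 0 < u) :
    exceedProbGiven lam (-1) β t u = exceedProb lam 1 (β + u) (t - u) := by
  refine measureReal_congr ?_
  filter_upwards [ae_regularWaiting hlam] with y hy
  exact propext (seqCons_mem_exceedSet_neg hy hu hβ)

theorem exceedProbGiven_pos (hlam : 0 < lam) {β t u : ℝ} (hu : 0 < u) (huβ : u ≤ β) :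
    exceedProbGiven lam 1 β t u = exceedProb lam (-1) (β - u) (t - u) := by
  refine measureReal_congr ?_
  filter_upwards [ae_regularWaiting hlam] with y hy
  exact propext (seqCons_mem_exceedSet_pos hy hu huβ)

theorem exceedProbGiven_of_lt (hlam : 0 < lam) {β t u : ℝ} (hβ : 0 ≤ β) (ht : β < t)
    (hu : β < u) : exceedProbGiven lam 1 β t u = 1 := by
  have := isProbabilityMeasure_expMeasure hlam
  refine (measureReal_congr (t := univ) ?_).trans probReal_univ
  filter_upwards [ae_regularWaiting hlam] with y hy
  exact propext (iff_true_right trivial |>.2 (seqCons_mem_exceedSet_of_lt hy hβ ht hu))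

theorem exceedProb_eq_zero {σ β t : ℝ} (hσ : |σ| = 1) (h : t ≤ β) :
    exceedProb lam σ β t = 0 := by
  rw [exceedProb, exceedSet_eq_empty hσ h, measureReal_empty]

/-- The integral stops at (t - β)/2: for larger u, the remaining time t - u is too short to climb to
β + u at unit speed. -/
theorem exceedProb_neg_renewal (hlam : 0 < lam) {β t : ℝ} (hβ : 0 ≤ β) (ht : β < t) :
    exceedProb lam (-1) β t = ∫ u in (0 : ℝ)..(t - β) / 2,
      lam * Real.exp (-(lam * u)) * exceedProb lam 1 (β + u) (t - u) := by
  rw [exceedProb_eq_integral hlam, intervalIntegral.integral_of_le (by linarith),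
    setIntegral_eq_of_subset_of_forall_sdiff_eq_zero (s := Ioc 0 ((t - β) / 2))
      (f := fun u => lam * Real.exp (-(lam * u)) * exceedProbGiven lam (-1) β t u)
      measurableSet_Ioi Ioc_subset_Ioi_self]
  · refine setIntegral_congr_fun measurableSet_Ioc fun u hu => ?_
    simp only [exceedProbGiven_neg hlam hβ hu.1]
  · rintro u ⟨hu, hu'⟩
    have hu2 : (t - β) / 2 < u := not_le.1 fun h => hu' ⟨hu, h⟩
    rw [exceedProbGiven_neg hlam hβ hu, exceedProb_eq_zero (by simp) (by linarith), mul_zero]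

theorem intervalIntegrable_exceedProb_neg (hlam : 0 < lam) {β t T : ℝ} (hβ : 0 ≤ β) (hT : 0 ≤ T) :
    IntervalIntegrable (fun u => lam * Real.exp (-(lam * u)) * exceedProb lam 1 (β + u) (t - u))
      volume 0 T := by
  rw [intervalIntegrable_iff_integrableOn_Ioc_of_le hT]
  refine ((integrableOn_rate_exp_mul_exceedProbGiven hlam (-1) β t).mono_set
    Ioc_subset_Ioi_self).congr_fun (fun u hu => ?_) measurableSet_Ioc
  simp only [exceedProbGiven_neg hlam hβ hu.1]

theorem intervalIntegrable_exceedProb_pos (hlam : 0 < lam) {β t : ℝ} (hβ : 0 ≤ β) :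
    IntervalIntegrable (fun u => lam * Real.exp (-(lam * u)) * exceedProb lam (-1) (β - u) (t - u))
      volume 0 β := by
  rw [intervalIntegrable_iff_integrableOn_Ioc_of_le hβ]
  refine ((integrableOn_rate_exp_mul_exceedProbGiven hlam 1 β t).mono_set
    Ioc_subset_Ioi_self).congr_fun (fun u hu => ?_) measurableSet_Ioc
  simp only [exceedProbGiven_pos hlam hu.1 hu.2]

/-- Split at u = β: a longer first leg crosses β by itself, which contributes the exponential. -/
theorem exceedProb_pos_renewal (hlam : 0 < lam) {β t : ℝ} (hβ : 0 ≤ β) (ht : β < t) :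
    exceedProb lam 1 β t = (∫ u in (0 : ℝ)..β,
      lam * Real.exp (-(lam * u)) * exceedProb lam (-1) (β - u) (t - u)) +
        Real.exp (-(lam * β)) := by
  have hint := integrableOn_rate_exp_mul_exceedProbGiven hlam 1 β t
  rw [exceedProb_eq_integral hlam, intervalIntegral.integral_of_le hβ, ← Ioc_union_Ioi_eq_Ioi hβ,
    setIntegral_union (by simp) measurableSet_Ioi (hint.mono_set Ioc_subset_Ioi_self)
      (hint.mono_set (Ioi_subset_Ioi hβ)), ← integral_rate_exp_Ioi hlam β]
  congr 1
  · refine setIntegral_congr_fun measurableSet_Ioc fun u hu => ?_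
    simp only [exceedProbGiven_pos hlam hu.1 hu.2]
  · refine setIntegral_congr_fun measurableSet_Ioi fun u hu => ?_
    simp only [exceedProbGiven_of_lt hlam hβ ht hu, mul_one]

/-- A downward leg of length u lowers x by λu and fixes y; the exponential factors combine to one
independent of u. -/
theorem rate_exp_mul_exceedSeries_up (lam β t u : ℝ) :
    lam * Real.exp (-(lam * u)) * exceedSeries lam upCoeff (β + u) (t - u) =
      Real.exp (-(lam * t)) * (lam * biexpSeries upCoeff (lam * (t - β) / 2 + -lam * u)
        (lam * (t + β) / 2 + 0 * u)) := by
  have h1 : Real.exp (-(lam * t)) = Real.exp (-(lam * u)) * Real.exp (-(lam * (t - u))) := by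
    rw [← Real.exp_add]
    ring_nf
  rw [exceedSeries, h1, show lam * (t - u - (β + u)) / 2 = lam * (t - β) / 2 + -lam * u by ring,
    show lam * (t - u + (β + u)) / 2 = lam * (t + β) / 2 + 0 * u by ring]
  ring

theorem rate_exp_mul_exceedSeries_down (lam β t u : ℝ) :
    lam * Real.exp (-(lam * u)) * exceedSeries lam downCoeff (β - u) (t - u) =
      Real.exp (-(lam * t)) * (lam * biexpSeries downCoeff (lam * (t - β) / 2 + 0 * u)
        (lam * (t + β) / 2 + -lam * u)) := by
  have h1 : Real.exp (-(lam * t)) = Real.exp (-(lam * u)) * Real.exp (-(lam * (t - u))) := by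
    rw [← Real.exp_add]
    ring_nf
  rw [exceedSeries, h1, show lam * (t - u - (β - u)) / 2 = lam * (t - β) / 2 + 0 * u by ring,
    show lam * (t - u + (β - u)) / 2 = lam * (t + β) / 2 + -lam * u by ring]
  ring

theorem intervalIntegrable_exceedSeries_up (lam β t T : ℝ) :
    IntervalIntegrable (fun u => lam * Real.exp (-(lam * u)) *
      exceedSeries lam upCoeff (β + u) (t - u)) volume 0 T := by
  simp only [rate_exp_mul_exceedSeries_up]
  exact (((continuous_biexpSeries_line abs_upCoeff_le _ _ _ _).const_mul _).const_mul
    _).intervalIntegrable _ _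

theorem intervalIntegrable_exceedSeries_down (lam β t T : ℝ) :
    IntervalIntegrable (fun u => lam * Real.exp (-(lam * u)) *
      exceedSeries lam downCoeff (β - u) (t - u)) volume 0 T := by
  simp only [rate_exp_mul_exceedSeries_down]
  exact (((continuous_biexpSeries_line abs_downCoeff_le _ _ _ _).const_mul _).const_mul
    _).intervalIntegrable _ _

/-- The integrand is an exact x-derivative, and the boundary term at the upper limit lies on x = 0,
where the series vanishes. -/
theorem exceedSeries_down_renewal (β t : ℝ) :
    exceedSeries lam downCoeff β t = ∫ u in (0 : ℝ)..(t - β) / 2,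
      lam * Real.exp (-(lam * u)) * exceedSeries lam upCoeff (β + u) (t - u) := by
  have hd (u : ℝ) : HasDerivAt
      (fun u => -biexpSeries downCoeff (lam * (t - β) / 2 + -lam * u) (lam * (t + β) / 2 + 0 * u))
      (lam * biexpSeries upCoeff (lam * (t - β) / 2 + -lam * u) (lam * (t + β) / 2 + 0 * u)) u := by
    refine (hasDerivAt_biexpSeries abs_downCoeff_le _ _ (-lam) 0 u).neg.congr_deriv ?_
    simp only [downCoeff, add_sub_cancel_right]
    ring
  simp only [rate_exp_mul_exceedSeries_up]
  rw [intervalIntegral.integral_const_mul, intervalIntegral.integral_eq_sub_of_hasDerivAt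
    (fun u _ => hd u) (((continuous_biexpSeries_line abs_upCoeff_le _ _ _ _).const_mul
    _).intervalIntegrable _ _), show lam * (t - β) / 2 + -lam * ((t - β) / 2) = 0 by ring,
    biexpSeries_zero_left (fun m hm => downCoeff_of_nonpos hm), exceedSeries]
  simp

/-- The integrand is an exact y-derivative; at u = β the two coordinates agree, and the diagonal
value gives the exponential term. -/
theorem exceedSeries_up_renewal (β t : ℝ) :
    exceedSeries lam upCoeff β t = (∫ u in (0 : ℝ)..β,
      lam * Real.exp (-(lam * u)) * exceedSeries lam downCoeff (β - u) (t - u)) +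
        Real.exp (-(lam * β)) := by
  have hd (u : ℝ) : HasDerivAt
      (fun u => -biexpSeries upCoeff (lam * (t - β) / 2 + 0 * u) (lam * (t + β) / 2 + -lam * u))
      (lam * biexpSeries downCoeff (lam * (t - β) / 2 + 0 * u) (lam * (t + β) / 2 + -lam * u))
      u := by
    refine (hasDerivAt_biexpSeries abs_upCoeff_le _ _ 0 (-lam) u).neg.congr_deriv ?_
    have : downCoeff = fun m => upCoeff (m - 1) := rfl
    rw [this]
    ring
  simp only [rate_exp_mul_exceedSeries_down]
  rw [intervalIntegral.integral_const_mul, intervalIntegral.integral_eq_sub_of_hasDerivAt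
    (fun u _ => hd u) (((continuous_biexpSeries_line abs_downCoeff_le _ _ _ _).const_mul
    _).intervalIntegrable _ _),
    show lam * (t + β) / 2 + -lam * β = lam * (t - β) / 2 + 0 * β by ring,
    show lam * (t - β) / 2 + 0 * β = lam * (t - β) / 2 by ring,
    biexpSeries_diag abs_upCoeff_le upCoeff_add_neg, exceedSeries]
  have h1 : Real.exp (-(lam * β)) =
      Real.exp (-(lam * t)) * Real.exp (2 * (lam * (t - β) / 2)) := by
    rw [← Real.exp_add]
    ring_nf
  rw [h1]
  simp
  ring

theorem abs_exceedSeries_le (hlam : 0 < lam) {α : ℤ → ℝ} (hα : ∀ m, |α m| ≤ 2) {β t : ℝ}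
    (hβ : 0 ≤ β) (ht : β ≤ t) : |exceedSeries lam α β t| ≤ 2 := by
  have h := abs_biexpSeries_le hα (x := lam * (t - β) / 2) (y := lam * (t + β) / 2)
    (div_nonneg (mul_nonneg hlam.le (by linarith)) zero_le_two)
    (div_nonneg (mul_nonneg hlam.le (by linarith)) zero_le_two)
  rw [exceedSeries, abs_mul, abs_of_pos (Real.exp_pos _)]
  calc _ ≤ Real.exp (-(lam * t)) * (2 * Real.exp (lam * (t - β) / 2 + lam * (t + β) / 2)) :=
        mul_le_mul_of_nonneg_left h (Real.exp_pos _).le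
    _ = 2 * (Real.exp (-(lam * t)) * Real.exp (lam * (t - β) / 2 + lam * (t + β) / 2)) := by ring
    _ = 2 := by
        rw [← Real.exp_add, show -(lam * t) + (lam * (t - β) / 2 + lam * (t + β) / 2) = 0 by ring,
          Real.exp_zero, mul_one]

theorem abs_exceedProb_sub_exceedSeries_le (hlam : 0 < lam) {α : ℤ → ℝ} (hα : ∀ m, |α m| ≤ 2)
    (σ : ℝ) {β t : ℝ} (hβ : 0 ≤ β) (ht : β ≤ t) :
    |exceedProb lam σ β t - exceedSeries lam α β t| ≤ 3 := by
  have := isProbabilityMeasure_expMeasure hlam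
  have h1 : 0 ≤ exceedProb lam σ β t := measureReal_nonneg
  have h2 : exceedProb lam σ β t ≤ 1 := measureReal_le_one
  have h3 := abs_le.1 (abs_exceedSeries_le hlam hα hβ ht)
  rw [abs_le]
  constructor <;> linarith

/-- The contraction estimate: the exponential law gives [0, T] mass at most 1 - e^{-λt}. The bound
on `D` is asked only for u < T, since at T = (t - β)/2 the restarted level equals the remaining
time. -/
theorem abs_integral_rate_exp_mul_le (hlam : 0 < lam) {D : ℝ → ℝ} {C T t : ℝ} (hC : 0 ≤ C)
    (hT : 0 ≤ T) (hTt : T ≤ t) (hD : ∀ u, 0 < u → u < T → |D u| ≤ C) :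
    |∫ u in (0 : ℝ)..T, lam * Real.exp (-(lam * u)) * D u| ≤
      C * (1 - Real.exp (-(lam * t))) := by
  have h1 : |∫ u in (0 : ℝ)..T, lam * Real.exp (-(lam * u)) * D u| ≤
      ∫ u in (0 : ℝ)..T, C * (lam * Real.exp (-(lam * u))) := by
    have hc : Continuous fun u => C * (lam * Real.exp (-(lam * u))) := by fun_prop
    rw [← Real.norm_eq_abs]
    refine intervalIntegral.norm_integral_le_of_norm_le hT ?_
      (hc.intervalIntegrable (μ := volume) _ _)
    have hne : ∀ᵐ v : ℝ, v ≠ T := by simp [ae_iff]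
    filter_upwards [hne] with u hu hmem
    rw [norm_mul, Real.norm_of_nonneg (by positivity), mul_comm]
    exact mul_le_mul_of_nonneg_right (hD u hmem.1 (lt_of_le_of_ne hmem.2 hu)) (by positivity)
  rw [intervalIntegral.integral_const_mul, integral_rate_exp] at h1
  refine h1.trans (mul_le_mul_of_nonneg_left (sub_le_sub_left (Real.exp_le_exp.2 ?_) _) hC)
  exact neg_le_neg (mul_le_mul_of_nonneg_left hTt hlam.le)

/-- Each renewal step shortens the remaining time, so a fixed horizon t gives one contraction factor
for all s ≤ t. The constant 3 bounds a probability plus a series of size at most 2. -/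
theorem abs_exceedProb_sub_exceedSeries_le_pow (hlam : 0 < lam) (t : ℝ) (n : ℕ) :
    ∀ β s, 0 ≤ β → β < s → s ≤ t →
      |exceedProb lam (-1) β s - exceedSeries lam downCoeff β s| ≤
          3 * (1 - Real.exp (-(lam * t))) ^ n ∧
        |exceedProb lam 1 β s - exceedSeries lam upCoeff β s| ≤
          3 * (1 - Real.exp (-(lam * t))) ^ n := by
  induction n with
  | zero =>
    intro β s hβ hs _
    rw [pow_zero, mul_one]
    exact ⟨abs_exceedProb_sub_exceedSeries_le hlam abs_downCoeff_le _ hβ hs.le,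
      abs_exceedProb_sub_exceedSeries_le hlam abs_upCoeff_le _ hβ hs.le⟩
  | succ n ih =>
    intro β s hβ hs hst
    have ht : 0 < t := by linarith
    have hq : 0 ≤ 1 - Real.exp (-(lam * t)) :=
      sub_nonneg.2 (Real.exp_le_one_iff.2 (neg_nonpos.2 (by positivity)))
    rw [pow_succ, ← mul_assoc]
    constructor
    · rw [exceedProb_neg_renewal hlam hβ hs, exceedSeries_down_renewal,
        ← intervalIntegral.integral_sub (intervalIntegrable_exceedProb_neg hlam hβ (by linarith))
          (intervalIntegrable_exceedSeries_up _ _ _ _)]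
      simp only [← mul_sub]
      exact abs_integral_rate_exp_mul_le hlam (by positivity) (by linarith) (by linarith)
        fun u hu hu' => (ih _ _ (by linarith) (by linarith) (by linarith)).2
    · rw [exceedProb_pos_renewal hlam hβ hs, exceedSeries_up_renewal, add_sub_add_right_eq_sub,
        ← intervalIntegral.integral_sub (intervalIntegrable_exceedProb_pos hlam hβ)
          (intervalIntegrable_exceedSeries_down _ _ _ _)]
      simp only [← mul_sub]
      exact abs_integral_rate_exp_mul_le hlam (by positivity) hβ (by linarith)
        fun u hu hu' => (ih _ _ (by linarith) (by linarith) (by linarith)).1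

/-- The probability that the path started downwards exceeds `β` by time `t`. -/
theorem exceedProb_neg_eq (hlam : 0 < lam) {β t : ℝ} (hβ : 0 ≤ β) (ht : β < t) :
    exceedProb lam (-1) β t = exceedSeries lam downCoeff β t := by
  have hq0 : 0 ≤ 1 - Real.exp (-(lam * t)) :=
    sub_nonneg.2 (Real.exp_le_one_iff.2 (neg_nonpos.2 (mul_nonneg hlam.le (by linarith))))
  have hq1 : 1 - Real.exp (-(lam * t)) < 1 := sub_lt_self _ (Real.exp_pos _)
  have hlim := (tendsto_pow_atTop_nhds_zero_of_lt_one hq0 hq1).const_mul 3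
  rw [mul_zero] at hlim
  have := ge_of_tendsto' hlim fun n =>
    (abs_exceedProb_sub_exceedSeries_le_pow hlam t n β t hβ ht le_rfl).1
  exact sub_eq_zero.1 (abs_nonpos_iff.1 this)

end

/-! ### The maximum, its density and its atom -/

/-- The maximum up to time `t` of the path with initial velocity `v` and waiting times `x`. -/
noncomputable def pathMax (v t : ℝ) (x : ℕ → ℝ) : ℝ :=
  sSup ((fun s => v * unitPath x s) '' Icc 0 t)

/-- Coefficients of the density of the maximum for a downward start. -/
def densityCoeff (m : ℤ) : ℝ := upCoeff m - upCoeff (m - 2)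

/-- The density of the maximum for a downward start, as a biexponential series. -/
noncomputable def densitySeries (c lam t β : ℝ) : ℝ :=
  Real.exp (-(lam * t)) * (lam / (2 * c) * biexpSeries densityCoeff
    (lam * t / 2 + -(lam / (2 * c)) * β) (lam * t / 2 + lam / (2 * c) * β))

theorem isGreatest_pathMax (v : ℝ) {t : ℝ} (ht : 0 ≤ t) (x : ℕ → ℝ) :
    IsGreatest ((fun s => v * unitPath x s) '' Icc 0 t) (pathMax v t x) :=
  (isCompact_Icc.image ((continuous_unitPath x).const_mul v)).isGreatest_sSup
    ((nonempty_Icc.2 ht).image _)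

theorem lt_pathMax_iff {v t β : ℝ} (ht : 0 ≤ t) {x : ℕ → ℝ} :
    β < pathMax v t x ↔ ∃ s ∈ Icc 0 t, β < v * unitPath x s := by
  have h := isGreatest_pathMax v ht x
  constructor
  · intro hlt
    obtain ⟨s, hs, hs'⟩ := h.1
    refine ⟨s, hs, ?_⟩
    rw [← hs'] at hlt
    exact hlt
  · rintro ⟨s, hs, hlt⟩
    exact hlt.trans_le (h.2 ⟨s, hs, rfl⟩)

theorem pathMax_nonneg (v : ℝ) {t : ℝ} (ht : 0 ≤ t) (x : ℕ → ℝ) : 0 ≤ pathMax v t x :=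
  (isGreatest_pathMax v ht x).2 ⟨0, ⟨le_rfl, ht⟩, by simp [unitPath_zero]⟩

/-- Joint measurability in the velocity is needed because V(0) is random. -/
theorem measurable_pathMax {t : ℝ} (ht : 0 ≤ t) :
    Measurable fun p : ℝ × (ℕ → ℝ) => pathMax p.1 t p.2 := by
  refine measurable_of_Ioi fun β => ?_
  have : (fun p : ℝ × (ℕ → ℝ) => pathMax p.1 t p.2) ⁻¹' Ioi β =
      {p | ∃ q : ℚ, β < p.1 * unitPath p.2 (max 0 (min (q : ℝ) t))} := by
    ext p
    exact (lt_pathMax_iff ht).trans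
      (exists_Icc_iff_exists_rat ((continuous_unitPath p.2).const_mul p.1) ht β)
  rw [this, ofPred_exists]
  exact MeasurableSet.iUnion fun q => measurableSet_lt measurable_const
    (measurable_fst.mul ((measurable_unitPath _).comp measurable_snd))

theorem measurable_pathMax_right (v : ℝ) {t : ℝ} (ht : 0 ≤ t) : Measurable (pathMax v t) :=
  (measurable_pathMax ht).comp measurable_prodMk_left

theorem pathMax_preimage_Ioi {c t : ℝ} (hc : 0 < c) (ht : 0 ≤ t) (β : ℝ) :
    pathMax (-c) t ⁻¹' Ioi β = exceedSet (-1) (β / c) t := by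
  ext x
  refine (lt_pathMax_iff ht).trans ?_
  refine exists_congr fun s => and_congr_right fun _ => ?_
  rw [div_lt_iff₀ hc]
  ring_nf

theorem densityCoeff_eq (m : ℤ) : densityCoeff m = 1 * (if m = (0 : ℕ) then 1 else 0) +
    1 * (2 * (if m = (1 : ℕ) then 1 else 0) + 1 * (if m = (2 : ℕ) then 1 else 0)) := by
  unfold densityCoeff upCoeff
  push_cast
  split_ifs <;> first | omega | norm_num

theorem densityCoeff_nonneg (m : ℤ) : 0 ≤ densityCoeff m := by
  rw [densityCoeff_eq]
  split_ifs <;> norm_num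

theorem abs_densityCoeff_le (m : ℤ) : |densityCoeff m| ≤ 4 := by
  rw [densityCoeff_eq]
  split_ifs <;> norm_num

theorem abs_ite_le (k : ℕ) (m : ℤ) : |(if m = k then 1 else 0 : ℝ)| ≤ 1 := by
  split_ifs <;> norm_num

theorem biexpSeries_density (x y : ℝ) : biexpSeries densityCoeff x y =
    biexpSeries (fun m => if m = (0 : ℕ) then 1 else 0) x y +
      2 * biexpSeries (fun m => if m = (1 : ℕ) then 1 else 0) x y +
        biexpSeries (fun m => if m = (2 : ℕ) then 1 else 0) x y := by
  have h : ∀ m : ℤ, |2 * (if m = (1 : ℕ) then 1 else 0 : ℝ) +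
      1 * (if m = (2 : ℕ) then 1 else 0)| ≤ 3 := fun m => by
    split_ifs <;> norm_num
  rw [show densityCoeff = _ from funext densityCoeff_eq, biexpSeries_linear (abs_ite_le 0) h,
    biexpSeries_linear (abs_ite_le 1) (abs_ite_le 2)]
  ring

/-- The coordinates satisfy ct - β = (2c/λ)x, ct + β = (2c/λ)y and λt = x + y; the series with
coefficients 1, 2, 1 then gives Bessel functions, with the index 2 term eliminated by the
recurrence. -/
theorem maxDensityNeg_eq_densitySeries {c lam t β : ℝ} (hc : 0 < c) (hlam : 0 < lam)
    (hβ : β ∈ Ioo 0 (c * t)) : maxDensityNeg c lam t β = densitySeries c lam t β := by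
  obtain ⟨h0, h1⟩ := hβ
  set x := lam * t / 2 + -(lam / (2 * c)) * β with hx
  set y := lam * t / 2 + lam / (2 * c) * β with hy
  have ha : c * t - β = 2 * c / lam * x := by rw [hx]; field_simp; ring
  have hb : c * t + β = 2 * c / lam * y := by rw [hy]; field_simp
  have hk : 0 < 2 * c / lam := by positivity
  have hx0 : 0 < x := by
    have : 0 < 2 * c / lam * x := by rw [← ha]; linarith
    exact (mul_pos_iff_of_pos_left hk).1 this
  have hy0 : 0 < y := by
    have : 0 < 2 * c / lam * y := by rw [← hb]; linarith
    exact (mul_pos_iff_of_pos_left hk).1 this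
  have hsq : lam / c * √(c ^ 2 * t ^ 2 - β ^ 2) = 2 * √(x * y) := by
    rw [show c ^ 2 * t ^ 2 - β ^ 2 = (c * t - β) * (c * t + β) by ring, ha, hb,
      show 2 * c / lam * x * (2 * c / lam * y) = (2 * c / lam) ^ 2 * (x * y) by ring,
      Real.sqrt_mul (by positivity), Real.sqrt_sq hk.le]
    field_simp
  have hdiv : (c * t - β) / (c * t + β) = x / y := by
    rw [ha, hb, mul_div_mul_left _ _ hk.ne']
  have hlt : lam * t = x + y := by rw [hx, hy]; ring
  have w0 := biexpSeries_single_eq_besselI 0 hx0.le hy0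
  have w1 := biexpSeries_single_eq_besselI 1 hx0.le hy0
  have w2 := biexpSeries_single_recurrence x y
  rw [pow_zero, one_mul] at w0
  rw [pow_one] at w1
  have w2' : biexpSeries (fun m => if m = (2 : ℕ) then 1 else 0) x y =
      (x * besselI 0 (2 * √(x * y)) - √(x / y) * besselI 1 (2 * √(x * y))) / y := by
    rw [eq_div_iff hy0.ne', mul_comm, w2, w0, w1]
  rw [maxDensityNeg, densitySeries, ← hx, ← hy, biexpSeries_density, w0, w1, w2', hsq, hdiv, hb,
    neg_mul, hlt]
  congr 1
  field_simp
  ring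

theorem densitySeries_nonneg {c lam t β : ℝ} (hc : 0 < c) (hlam : 0 < lam)
    (hβ : β ∈ Icc 0 (c * t)) : 0 ≤ densitySeries c lam t β := by
  have ht : 0 ≤ t := nonneg_of_mul_nonneg_right (hβ.1.trans hβ.2) hc
  have hy : 0 ≤ lam * t / 2 + lam / (2 * c) * β := by
    have := hβ.1
    positivity
  have hx : 0 ≤ lam * t / 2 + -(lam / (2 * c)) * β := by
    have : lam * t / 2 + -(lam / (2 * c)) * β = lam / (2 * c) * (c * t - β) := by
      field_simp
      ring
    rw [this]
    exact mul_nonneg (by positivity) (sub_nonneg.2 hβ.2)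
  refine mul_nonneg (Real.exp_pos _).le (mul_nonneg (by positivity) ?_)
  exact tsum_nonneg fun p => mul_nonneg (densityCoeff_nonneg _) (by positivity)

theorem continuous_densitySeries (c lam t : ℝ) : Continuous (densitySeries c lam t) :=
  ((continuous_biexpSeries_line abs_densityCoeff_le _ _ _ _).const_mul _).const_mul _

/-- As β grows, x and y move at opposite rates ∓λ/(2c), so the coefficients become a difference of
two shifts of `downCoeff`. -/
theorem hasDerivAt_exceedSeries_down (c lam t β : ℝ) :
    HasDerivAt (fun β => -exceedSeries lam downCoeff (β / c) t) (densitySeries c lam t β) β := by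
  have h := ((hasDerivAt_biexpSeries abs_downCoeff_le (lam * t / 2) (lam * t / 2)
    (-(lam / (2 * c))) (lam / (2 * c)) β).const_mul (Real.exp (-(lam * t)))).neg
  have hfun : (fun β => -exceedSeries lam downCoeff (β / c) t) = fun u =>
      -(Real.exp (-(lam * t)) * biexpSeries downCoeff (lam * t / 2 + -(lam / (2 * c)) * u)
        (lam * t / 2 + lam / (2 * c) * u)) := by
    funext u
    rw [exceedSeries, show lam * (t - u / c) / 2 = lam * t / 2 + -(lam / (2 * c)) * u by ring,
      show lam * (t + u / c) / 2 = lam * t / 2 + lam / (2 * c) * u by ring]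
  rw [hfun]
  refine h.congr_deriv ?_
  have h1 : (fun m => downCoeff (m + 1)) = upCoeff := by
    funext m
    rw [downCoeff, add_sub_cancel_right]
  have h2 : (fun m => downCoeff (m - 1)) = fun m => upCoeff (m - 2) := by
    funext m
    rw [downCoeff, sub_sub, one_add_one_eq_two]
  have h3 : densityCoeff = fun m => 1 * upCoeff m + -1 * upCoeff (m - 2) := by
    funext m
    rw [densityCoeff]
    ring
  rw [h1, h2, densitySeries, h3, biexpSeries_linear abs_upCoeff_le fun m => abs_upCoeff_le _]
  ring

theorem exceedSeries_down_of_eq (lam t : ℝ) : exceedSeries lam downCoeff t t = 0 := by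
  rw [exceedSeries, sub_self, mul_zero, zero_div,
    biexpSeries_zero_left fun m hm => downCoeff_of_nonpos hm, mul_zero]

theorem integral_densitySeries (c lam t a b : ℝ) : ∫ β in a..b, densitySeries c lam t β =
    exceedSeries lam downCoeff (a / c) t - exceedSeries lam downCoeff (b / c) t := by
  rw [intervalIntegral.integral_eq_sub_of_hasDerivAt
    (fun β _ => hasDerivAt_exceedSeries_down c lam t β)
    ((continuous_densitySeries c lam t).intervalIntegrable _ _)]
  ring

theorem one_sub_exceedSeries_down_zero {lam t : ℝ} (hlam : 0 < lam) (ht : 0 < t) :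
    1 - exceedSeries lam downCoeff 0 t =
      Real.exp (-lam * t) * (besselI 0 (lam * t) + besselI 1 (lam * t)) := by
  set x := lam * t / 2 with hx
  have hx0 : 0 < x := by positivity
  -- `downCoeff` is `upCoeff` minus the indicators of 0 and 1; at β = 0 these parts give the total
  -- mass 1, I₀ and I₁.
  have hc : downCoeff = fun m => 1 * upCoeff m + -1 * (1 * (if m = (0 : ℕ) then 1 else 0) +
      1 * (if m = (1 : ℕ) then 1 else 0)) := by
    funext m
    unfold downCoeff upCoeff
    push_cast
    split_ifs <;> first | omega | norm_num
  have hb : ∀ m : ℤ, |1 * (if m = (0 : ℕ) then 1 else 0 : ℝ) +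
      1 * (if m = (1 : ℕ) then 1 else 0)| ≤ 2 := fun m => by
    split_ifs <;> norm_num
  rw [exceedSeries, sub_zero, add_zero, ← hx, hc, biexpSeries_linear abs_upCoeff_le hb,
    biexpSeries_linear (abs_ite_le 0) (abs_ite_le 1), biexpSeries_diag abs_upCoeff_le
    upCoeff_add_neg, biexpSeries_single_eq_besselI 0 hx0.le hx0,
    biexpSeries_single_eq_besselI 1 hx0.le hx0, div_self hx0.ne', Real.sqrt_mul_self hx0.le,
    show 2 * x = lam * t by rw [hx]; ring, neg_mul lam]
  have : Real.exp (-(lam * t)) * Real.exp (lam * t) = 1 := by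
    rw [← Real.exp_add, neg_add_cancel, Real.exp_zero]
  simp only [Real.sqrt_one, one_pow, one_mul]
  linear_combination -this

/-! ### Law of the maximum for a downward start -/

section

variable {c lam t : ℝ}

/-- Capping β at ct covers all β ≥ 0 in one formula, since both sides vanish from ct on. -/
theorem infinitePi_real_pathMax_Ioi (hc : 0 < c) (hlam : 0 < lam) (ht : 0 < t) {β : ℝ}
    (hβ : 0 ≤ β) : (Measure.infinitePi fun _ : ℕ => expMeasure lam).real
      (pathMax (-c) t ⁻¹' Ioi β) = exceedSeries lam downCoeff (min β (c * t) / c) t := by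
  rw [pathMax_preimage_Ioi hc ht.le]
  change exceedProb lam (-1) (β / c) t = _
  rcases lt_or_ge β (c * t) with h | h
  · rw [min_eq_left h.le, exceedProb_neg_eq hlam (by positivity) ((div_lt_iff₀' hc).2 h)]
  · rw [min_eq_right h, mul_div_cancel_left₀ _ hc.ne', exceedSeries_down_of_eq,
      exceedProb_eq_zero (by simp) ((le_div_iff₀' hc).2 h)]

/-- Off the origin, the maximum of the path started downwards has the density
`densitySeries`. -/
theorem map_pathMax_restrict_Ioi (hc : 0 < c) (hlam : 0 < lam) (ht : 0 < t) :
    ((Measure.infinitePi fun _ : ℕ => expMeasure lam).map (pathMax (-c) t)).restrict (Ioi 0) =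
      (volume.restrict (Ioo 0 (c * t))).withDensity
        fun β => ENNReal.ofReal (densitySeries c lam t β) := by
  have := isProbabilityMeasure_expMeasure hlam
  set μ := Measure.infinitePi fun _ : ℕ => expMeasure lam
  have hM := measurable_pathMax_right (-c) ht.le
  have hct : 0 < c * t := by positivity
  refine Measure.ext_of_Iic _ _ fun a => ?_
  rw [Measure.restrict_apply measurableSet_Iic, withDensity_apply _ measurableSet_Iic,
    Measure.restrict_restrict measurableSet_Iic, inter_comm (Iic a) (Ioi 0), Ioi_inter_Iic]
  rcases le_or_gt a 0 with ha | ha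
  · have : Iic a ∩ Ioo 0 (c * t) = ∅ := by
      ext z
      simp only [mem_inter_iff, mem_Iic, mem_Ioo, mem_empty_iff_false, iff_false]
      rintro ⟨h1, h2, -⟩
      linarith
    simp [this, Ioc_eq_empty ha.not_gt]
  · have hm : 0 < min a (c * t) := lt_min ha hct
    have hset : (Iic a ∩ Ioo 0 (c * t) : Set ℝ) =ᵐ[volume] Ioc 0 (min a (c * t)) := by
      have hne : ∀ᵐ v : ℝ, v ≠ c * t := by simp [ae_iff]
      filter_upwards [hne] with v hv
      refine propext ⟨fun ⟨h1, h2, h3⟩ => ⟨h2, le_min h1 h3.le⟩, fun ⟨h1, h2⟩ => ?_⟩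
      exact ⟨h2.trans (min_le_left _ _), h1, lt_of_le_of_ne (h2.trans (min_le_right _ _)) hv⟩
    rw [setLIntegral_congr hset, ← ofReal_integral_eq_lintegral_ofReal
      (((continuous_densitySeries c lam t).integrableOn_Icc).mono_set Ioc_subset_Icc_self)
      ((ae_restrict_mem measurableSet_Ioc).mono fun β hβ => densitySeries_nonneg hc hlam
        ⟨hβ.1.le, hβ.2.trans (min_le_right _ _)⟩), ← intervalIntegral.integral_of_le hm.le,
      integral_densitySeries, Measure.map_apply hM measurableSet_Ioc, ← ofReal_measureReal]
    congr 1
    rw [← Ioi_sdiff_Ioi, preimage_sdiff, measureReal_sdiff (preimage_mono (Ioi_subset_Ioi ha.le))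
      (hM measurableSet_Ioi), infinitePi_real_pathMax_Ioi hc hlam ht le_rfl,
      infinitePi_real_pathMax_Ioi hc hlam ht ha.le, min_eq_left hct.le]

theorem infinitePi_real_pathMax_eq_integral (hc : 0 < c) (hlam : 0 < lam) (ht : 0 < t)
    {A : Set ℝ} (hA : MeasurableSet A) (hsub : A ⊆ Ioo 0 (c * t)) :
    (Measure.infinitePi fun _ : ℕ => expMeasure lam).real (pathMax (-c) t ⁻¹' A) =
      ∫ β in A, maxDensityNeg c lam t β := by
  have hM := measurable_pathMax_right (-c) ht.le
  have hint : IntegrableOn (densitySeries c lam t) A :=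
    ((continuous_densitySeries c lam t).integrableOn_Icc).mono_set
      (hsub.trans Ioo_subset_Icc_self)
  rw [setIntegral_congr_fun hA fun β hβ => maxDensityNeg_eq_densitySeries hc hlam (hsub hβ),
    integral_eq_lintegral_of_nonneg_ae ((ae_restrict_mem hA).mono fun β hβ =>
      densitySeries_nonneg hc hlam (Ioo_subset_Icc_self (hsub hβ))) hint.aestronglyMeasurable,
    measureReal_def, ← Measure.map_apply hM hA]
  congr 1
  have h := congrArg (fun m : Measure ℝ => m A) (map_pathMax_restrict_Ioi hc hlam ht)
  simp only [Measure.restrict_apply hA, withDensity_apply _ hA, Measure.restrict_restrict hA,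
    inter_eq_left.2 hsub, inter_eq_left.2 (hsub.trans Ioo_subset_Ioi_self)] at h
  exact h

theorem infinitePi_real_pathMax_eq_zero (hc : 0 < c) (hlam : 0 < lam) (ht : 0 < t) :
    (Measure.infinitePi fun _ : ℕ => expMeasure lam).real {x | pathMax (-c) t x = 0} =
      Real.exp (-lam * t) * (besselI 0 (lam * t) + besselI 1 (lam * t)) := by
  have := isProbabilityMeasure_expMeasure hlam
  have hM := measurable_pathMax_right (-c) ht.le
  have hset : {x | pathMax (-c) t x = 0} = (pathMax (-c) t ⁻¹' Ioi 0)ᶜ := by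
    ext x
    simp only [mem_ofPred_eq, mem_compl_iff, mem_preimage, mem_Ioi, not_lt]
    exact ⟨fun h => h.le, fun h => h.antisymm (pathMax_nonneg _ ht.le x)⟩
  rw [hset, probReal_compl_eq_one_sub (hM measurableSet_Ioi),
    infinitePi_real_pathMax_Ioi hc hlam ht le_rfl, min_eq_left (by positivity), zero_div,
    one_sub_exceedSeries_down_zero hlam ht]

end

/-! ### Recovering the waiting times from the counting process -/

theorem sum_range_le_sum_range {x : ℕ → ℝ} (hx : ∀ n, 0 < x n) {m n : ℕ} (h : m ≤ n) :
    ∑ i ∈ Finset.range m, x i ≤ ∑ i ∈ Finset.range n, x i :=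
  Finset.sum_le_sum_of_subset_of_nonneg (Finset.range_subset_range.2 h) fun i _ _ => (hx i).le

/-- Arrival times increase, so the counted indices form an initial segment of ℕ. -/
theorem succ_le_arrivalCount_iff {x : ℕ → ℝ} (hx : RegularWaiting x) (n : ℕ) (u : ℝ) :
    n + 1 ≤ arrivalCount x u ↔ ∑ i ∈ Finset.range (n + 1), x i ≤ u := by
  constructor
  · intro h
    by_contra hn
    have hsub : {k : ℕ | ∑ i ∈ Finset.range (k + 1), x i ≤ u} ⊆ Iio n := fun k hk => by
      by_contra hkn
      exact hn ((sum_range_le_sum_range hx.1 (Nat.succ_le_succ (not_lt.1 hkn))).trans hk)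
    have hcard : (Iio n).ncard = n := by rw [ncard_eq_toFinset_card', toFinset_Iio, Nat.card_Iio]
    have := ncard_le_ncard hsub (finite_Iio n)
    unfold arrivalCount at h
    omega
  · intro h
    have hsub : Iic n ⊆ {k : ℕ | ∑ i ∈ Finset.range (k + 1), x i ≤ u} := fun k hk =>
      (sum_range_le_sum_range hx.1 (Nat.succ_le_succ hk)).trans h
    have hcard : (Iic n).ncard = n + 1 := by
      rw [ncard_eq_toFinset_card', toFinset_Iic, Nat.card_Iic]
    exact hcard.symm.trans_le (ncard_le_ncard hsub (hx.2 u))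

/-- The `n`-th arrival time read off a counting path at rational times. -/
noncomputable def arrivalTime (f : ℝ≥0 → ℕ) (n : ℕ) : ENNReal :=
  ⨅ q : ℚ, if n + 1 ≤ f (Real.toNNReal q) then ((Real.toNNReal q : ℝ≥0) : ENNReal) else ⊤

/-- The waiting times read off a counting path. -/
noncomputable def waitingTimes (f : ℝ≥0 → ℕ) : ℕ → ℝ
  | 0 => (arrivalTime f 0).toReal
  | n + 1 => (arrivalTime f (n + 1)).toReal - (arrivalTime f n).toReal

theorem measurable_arrivalTime (n : ℕ) : Measurable fun f : ℝ≥0 → ℕ => arrivalTime f n :=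
  Measurable.iInf fun q => Measurable.ite
    ((measurable_pi_apply (Real.toNNReal q)) (measurableSet_Ici (a := n + 1)))
    measurable_const measurable_const

theorem measurable_waitingTimes : Measurable waitingTimes := by
  refine measurable_pi_iff.2 fun n => ?_
  rcases n with _ | n
  · exact (measurable_arrivalTime 0).ennreal_toReal
  · exact (measurable_arrivalTime (n + 1)).ennreal_toReal.sub
      (measurable_arrivalTime n).ennreal_toReal

/-- The infimum over rational times is the true arrival time by density; restricting to rationals
keeps it measurable for the product σ-algebra. -/
theorem arrivalTime_eq {x : ℕ → ℝ} (hx : RegularWaiting x) {f : ℝ≥0 → ℕ}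
    (hf : ∀ u : ℝ≥0, f u = arrivalCount x u) (n : ℕ) :
    arrivalTime f n = ENNReal.ofReal (∑ i ∈ Finset.range (n + 1), x i) := by
  simp only [arrivalTime, hf, succ_le_arrivalCount_iff hx]
  refine le_antisymm (le_of_forall_gt_imp_ge_of_dense fun b hb => ?_) (le_iInf fun q => ?_)
  · obtain ⟨q, -, h1, h2⟩ := ENNReal.lt_iff_exists_rat_btwn.1 hb
    refine (iInf_le _ q).trans ?_
    rw [if_pos]
    · exact h2.le
    · exact Real.toNNReal_le_iff_le_coe.1 (ENNReal.coe_lt_coe.1 h1).le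
  · split_ifs with h
    · exact ENNReal.coe_le_coe.2 (Real.toNNReal_le_iff_le_coe.2 h)
    · exact le_top

theorem waitingTimes_eq {x : ℕ → ℝ} (hx : RegularWaiting x) {f : ℝ≥0 → ℕ}
    (hf : ∀ u : ℝ≥0, f u = arrivalCount x u) : waitingTimes f = x := by
  have h (n : ℕ) : (arrivalTime f n).toReal = ∑ i ∈ Finset.range (n + 1), x i := by
    rw [arrivalTime_eq hx hf,
      ENNReal.toReal_ofReal (Finset.sum_nonneg fun i _ => (hx.1 i).le)]
  funext n
  rcases n with _ | n
  · rw [waitingTimes, h]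
    simp
  · rw [waitingTimes, h, h, Finset.sum_range_succ _ (n + 1), add_sub_cancel_left]

/-! ### Transfer to the telegraph process -/

theorem telegraph_eq_mul_unitPath {Ω : Type*} {V₀ : Ω → ℝ} {N : ℝ≥0 → Ω → ℕ} {ω : Ω}
    {x : ℕ → ℝ} (hN : ∀ u : ℝ≥0, N u ω = arrivalCount x u) {s : ℝ} (hs : 0 ≤ s) :
    telegraph V₀ N s ω = V₀ ω * unitPath x s := by
  rw [telegraph, unitPath, ← intervalIntegral.integral_const_mul]
  refine intervalIntegral.integral_congr fun u hu => ?_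
  rw [uIcc_of_le hs] at hu
  simp only [hN, Real.coe_toNNReal u hu.1]

theorem image_telegraph_eq {Ω : Type*} {V₀ : Ω → ℝ} {N : ℝ≥0 → Ω → ℕ} {ω : Ω}
    {x : ℕ → ℝ} (hN : ∀ u : ℝ≥0, N u ω = arrivalCount x u) (t : ℝ) :
    (fun s => telegraph V₀ N s ω) '' Icc 0 t = (fun s => V₀ ω * unitPath x s) '' Icc 0 t :=
  image_congr fun _ hs => telegraph_eq_mul_unitPath hN hs.1

theorem mainTheorem6 {Ω : Type*} [MeasurableSpace Ω] (P : Measure Ω) [IsProbabilityMeasure P]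
    (V₀ : Ω → ℝ) (N : ℝ≥0 → Ω → ℕ) (c lam t : ℝ) (hc : 0 < c) (hlam : 0 < lam) (ht : 0 < t)
    (hT : IsSymmetricTelegraph V₀ N c lam P) :
    AEMeasurable (telegraphMax V₀ N t) P ∧
    (∀ᵐ ω ∂P, IsGreatest ((fun s => telegraph V₀ N s ω) '' Icc 0 t) (telegraphMax V₀ N t ω)) ∧
    IntegrableOn (maxDensityNeg c lam t) (Ioo 0 (c * t)) ∧
    (∀ A : Set ℝ, MeasurableSet A → A ⊆ Ioo 0 (c * t) →
      (P[|V₀ ⁻¹' {-c}]).real {ω | telegraphMax V₀ N t ω ∈ A} =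
        ∫ β in A, maxDensityNeg c lam t β) ∧
    (P[|V₀ ⁻¹' {-c}]).real {ω | telegraphMax V₀ N t ω = 0} =
      Real.exp (-lam * t) * (besselI 0 (lam * t) + besselI 1 (lam * t)) := by
  have := isProbabilityMeasure_expMeasure hlam
  obtain ⟨-, τ, hτ, hind, hlaw, hN⟩ := hT.poisson
  set μ := Measure.infinitePi fun _ : ℕ => expMeasure lam with hμ
  set W : Ω → ℕ → ℝ := fun ω n => τ n ω with hW
  have hWm : Measurable W := measurable_pi_iff.2 hτ
  have hmap : P.map W = μ := (hind.hasLaw_infinitePi hlaw hWm.aemeasurable).map_eq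
  have hNW : ∀ᵐ ω ∂P, ∀ u : ℝ≥0, N u ω = arrivalCount (W ω) u := hN
  have hreg : ∀ᵐ ω ∂P, RegularWaiting (W ω) :=
    ae_of_ae_map hWm.aemeasurable (by rw [hmap]; exact ae_regularWaiting hlam)
  have hmax : ∀ᵐ ω ∂P, telegraphMax V₀ N t ω = pathMax (V₀ ω) t (W ω) := by
    filter_upwards [hNW] with ω h
    rw [telegraphMax, image_telegraph_eq h, pathMax]
  -- Independence is assumed for N only; it passes to the waiting times, which are almost surely a
  -- measurable function of the path of N.
  have hindep : IndepFun V₀ W P := by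
    refine (hT.indep.comp measurable_id measurable_waitingTimes).congr Filter.EventuallyEq.rfl ?_
    filter_upwards [hNW, hreg] with ω h1 h2
    exact waitingTimes_eq h2 h1
  have hmeas : MeasurableSet (V₀ ⁻¹' {-c}) := hT.measurable_velocity (measurableSet_singleton _)
  have hne : P (V₀ ⁻¹' {-c}) ≠ 0 := by
    rw [hT.velocity_neg]
    simp
  -- By independence, conditioning on V(0) = -c leaves the law of the waiting times unchanged.
  have hcond (B : Set (ℕ → ℝ)) (hB : MeasurableSet B) :
      (P[|V₀ ⁻¹' {-c}]).real (W ⁻¹' B) = μ.real B := by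
    rw [measureReal_def, cond_apply hmeas,
      hindep.measure_inter_preimage_eq_mul _ _ (measurableSet_singleton _) hB, ← mul_assoc,
      ENNReal.inv_mul_cancel hne (measure_ne_top _ _), one_mul, ← Measure.map_apply hWm hB, hmap,
      measureReal_def]
  have hcmax : ∀ᵐ ω ∂P[|V₀ ⁻¹' {-c}], telegraphMax V₀ N t ω = pathMax (-c) t (W ω) := by
    filter_upwards [cond_absolutelyContinuous.ae_le hmax, ae_cond_mem hmeas] with ω h1 h2
    rw [h1, show V₀ ω = -c from h2]
  have hM := measurable_pathMax_right (-c) ht.le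
  refine ⟨?_, ?_, ?_, fun A hA hsub => ?_, ?_⟩
  · exact ⟨_, (measurable_pathMax ht.le).comp (hT.measurable_velocity.prodMk hWm), hmax⟩
  · filter_upwards [hNW] with ω h
    rw [telegraphMax, image_telegraph_eq h]
    exact isGreatest_pathMax _ ht.le _
  · refine IntegrableOn.congr_fun ?_
      (fun β hβ => (maxDensityNeg_eq_densitySeries hc hlam hβ).symm) measurableSet_Ioo
    exact ((continuous_densitySeries c lam t).integrableOn_Icc).mono_set Ioo_subset_Icc_self
  · rw [← infinitePi_real_pathMax_eq_integral hc hlam ht hA hsub, ← hμ, ← hcond _ (hM hA)]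
    refine measureReal_congr (Filter.eventuallyEq_set.2 ?_)
    filter_upwards [hcmax] with ω h
    simp [h]
  · rw [← infinitePi_real_pathMax_eq_zero hc hlam ht, ← hμ]
    refine Eq.trans ?_ (hcond (pathMax (-c) t ⁻¹' {0}) (hM (measurableSet_singleton 0)))
    refine measureReal_congr (Filter.eventuallyEq_set.2 ?_)
    filter_upwards [hcmax] with ω h
    simp [h]
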